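/- Let $X=\mathbb R/\mathbb Z$ be the circle with normalized Lebesgue measure $m$. Let $\eta>0$ and let $(T_\delta)_{\delta\in[0,\eta)}$ be orientation preserving $C^3$ expanding maps of $X$ (that is, $T_\delta:X\to X$ is $C^3$ and $T_\delta'(x)>1$ for all $x\in X$), and suppose that the family is differentiable at $\delta=0$: there is $\epsilon\in C^3(X,\mathbb R)$ with $$T_\delta=T_0+\delta\epsilon+o_{C^3}(\delta)\qquad(\delta\to0^+),$$ where $o_{C^3}(\delta)$ is a term whose norm $\|r\|_{C^3}=\sup|r|+\sup|r'|+\sup|r''|+\sup|r'''|$ is $o(\delta)$. Let $W^{1,1}$ be the space of absolutely continuous functions on $X$ with norm $\|f\|_{W^{1,1}}=\int|f|\,dm+\int|f'|\,dm$, let $(L_\delta w)(x)=\sum_{y\in T_\delta^{-1}(x)}w(y)/|T_\delta'(y)|$ be the transfer operator of $T_\delta$, and for $w\in C^2(X,\mathbb R)$ put $$\hat Lw=-L_0\!\left(\frac{w\,\epsilon'}{T_0'}\right)-L_0\!\left(\frac{\epsilon\, w'}{T_0'}\right)+L_0\!\left(\frac{\epsilon\, T_0''}{(T_0')^2}\,w\right).$$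 Then every $T_\delta$ has exactly one invariant probability density $f_\delta$ in $W^{1,1}$; it belongs to $C^2(X,\mathbb R)$, in particular to $C^1(X,\mathbb R)$. The map $\delta\mapsto f_\delta$ is (right) differentiable at $\delta=0$ in $W^{1,1}$, with $$\lim_{\delta\to0^+}\left\|\frac{f_\delta-f_0}{\delta}-(1-L_0)^{-1}\hat Lf_0\right\|_{W^{1,1}}=0 .$$ Here $(1-L_0)^{-1}\hat Lf_0$ is an element $h\in W^{1,1}$ with $\int h\,dm=0$ and $(1-L_0)h=\hat Lf_0$, and it equals $\sum_{i\ge0}L_0^i\hat Lf_0$, the series converging in $W^{1,1}$. -/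

import Mathlib

open MeasureTheory Filter Topology Set

/-- The circle `X = ℝ / ℤ`; its `volume` is the normalized Lebesgue measure `m`. -/
abbrev X : Type := UnitAddCircle

namespace CircleMap

/-- The derivative of a real-valued function on the circle. -/
noncomputable def fderivX (f : X → ℝ) (x : X) : ℝ :=
  deriv (fun t : ℝ => f (x + (t : X))) 0

/-- `f ∈ C^n(X, ℝ)`. -/
def IsCk (n : ℕ) (f : X → ℝ) : Prop :=
  ContDiff ℝ n (fun t : ℝ => f (t : X))

/-- The `C^3` norm: the sum of the suprema of `|f|`, `|f'|`, `|f''|`, `|f'''|`. -/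
noncomputable def c3Norm (f : X → ℝ) : ℝ :=
  ∑ k ∈ Finset.range 4, ⨆ x : X, |fderivX^[k] f x|

/-- `f ∈ W^{1,1}`: `f` is absolutely continuous on the circle. -/
def IsW11 (f : X → ℝ) : Prop :=
  AbsolutelyContinuousOnInterval (fun t : ℝ => f (t : X)) 0 1

/-- The `W^{1,1}` norm `‖f‖_1 + ‖f'‖_1`. -/
noncomputable def w11Norm (f : X → ℝ) : ℝ :=
  (∫ x : X, |f x|) + ∫ x : X, |fderivX f x|

/-- `u a → f` in the normed space `W^{1,1}`, as `a` runs along the filter `l`. -/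
def TendstoW11 {ι : Type*} (u : ι → X → ℝ) (l : Filter ι) (f : X → ℝ) : Prop :=
  (∀ᶠ a in l, IsW11 (u a)) ∧ IsW11 f ∧
    Tendsto (fun a => w11Norm (fun x => u a x - f x)) l (𝓝 0)

/-- The derivative `T'(x)` of a circle map: the derivative at `t = 0` of the representative
in `(-1/2, 1/2]` of `T (x + t) - T x`. -/
noncomputable def mapDeriv (T : X → X) (x : X) : ℝ :=
  deriv (fun t : ℝ =>
    ((AddCircle.equivIoc (1 : ℝ) (-1 / 2) (T (x + (t : X)) - T x) : ℝ))) 0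

/-- `mapDeriv` is computed by any lift of the map. -/
theorem mapDeriv_of_lift {T : X → X} {F : ℝ → ℝ} (hF : ∀ t : ℝ, T (t : X) = (F t : X))
    (s : ℝ) (hc : ContinuousAt F s) : mapDeriv T (s : X) = deriv F s := by
  have h0 : Tendsto (fun t : ℝ => F (s + t) - F s) (𝓝 0) (𝓝 0) := by
    have h1 : Tendsto (fun t : ℝ => s + t) (𝓝 0) (𝓝 s) := by
      have : Tendsto (fun t : ℝ => s + t) (𝓝 0) (𝓝 (s + 0)) :=
        (continuous_const.add continuous_id).tendsto 0
      simpa using this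
    simpa using (hc.tendsto.comp h1).sub_const (F s)
  have hev : (fun t : ℝ =>
      ((AddCircle.equivIoc (1 : ℝ) (-1 / 2) (T ((s : X) + (t : X)) - T (s : X)) : ℝ)))
      =ᶠ[𝓝 0] fun t => F (s + t) - F s := by
    have hm : Ioo (-1 / 2 : ℝ) (1 / 2) ∈ 𝓝 (0 : ℝ) := Ioo_mem_nhds (by norm_num) (by norm_num)
    filter_upwards [h0 hm] with t ht
    have ht' : F (s + t) - F s ∈ Ioc (-1 / 2 : ℝ) (-1 / 2 + 1) :=
      ⟨ht.1, by have := ht.2; linarith⟩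
    have e : T ((s : X) + (t : X)) - T (s : X) = ((F (s + t) - F s : ℝ) : X) := by
      rw [← AddCircle.coe_add, hF, hF, AddCircle.coe_sub]
    rw [e]
    exact AddCircle.equivIoc_coe_of_mem ht'
  unfold mapDeriv
  rw [hev.deriv_eq, deriv_sub_const, deriv_comp_const_add, add_zero]

/-- A `C^3` orientation preserving expanding map of the circle: it has a `C^3` lift to `ℝ`,
and `T' > 1` everywhere. -/
structure IsExpandingC3 (T : X → X) : Prop where
  smooth : ∃ F : ℝ → ℝ, ContDiff ℝ 3 F ∧ ∀ t : ℝ, T (t : X) = (F t : X)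
  expanding : ∀ x : X, 1 < mapDeriv T x

/-- A family `T_δ`, `δ ∈ [0, η)`, of `C^3` expanding circle maps that is differentiable at `0`:
`T_δ = T_0 + δ ε + r_δ` modulo `1`, with `ε ∈ C^3` and `‖r_δ‖_{C^3} / δ → 0` as `δ → 0⁺`. -/
structure IsDifferentiableFamily (η : ℝ) (T : ℝ → X → X) (ε : X → ℝ) : Prop where
  expanding : ∀ δ ∈ Ico 0 η, IsExpandingC3 (T δ)
  smooth : IsCk 3 ε
  expansion : ∃ r : ℝ → X → ℝ,
    (∀ᶠ δ in 𝓝[>] (0 : ℝ), IsCk 3 (r δ) ∧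
      ∀ x : X, T δ x = T 0 x + ((δ * ε x + r δ x : ℝ) : X)) ∧
    Tendsto (fun δ => c3Norm (r δ) / δ) (𝓝[>] 0) (𝓝 0)

/-- The transfer operator `[L f](x) = ∑_{y ∈ T⁻¹(x)} f(y) / |T'(y)|`. -/
noncomputable def transfer (T : X → X) (f : X → ℝ) (x : X) : ℝ :=
  ∑ᶠ y ∈ T ⁻¹' {x}, f y / |mapDeriv T y|

/-- `f` is the density of a `T`-invariant probability measure `f m`, with `f ∈ W^{1,1}`. -/
structure IsInvariantDensity (T : X → X) (f : X → ℝ) : Prop where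
  w11 : IsW11 f
  nonneg : ∀ x, 0 ≤ f x
  integral_eq_one : ∫ x : X, f x = 1
  invariant : MeasurePreserving T
    ((volume : Measure X).withDensity fun x => ENNReal.ofReal (f x))
    ((volume : Measure X).withDensity fun x => ENNReal.ofReal (f x))

/-- The derivative operator
`L̂ w = - L_0 (w ε' / T_0') - L_0 (ε w' / T_0') + L_0 (ε T_0'' w / T_0'^2)`. -/
noncomputable def derivOp (T₀ : X → X) (ε w : X → ℝ) (x : X) : ℝ :=
  - transfer T₀ (fun y => w y * fderivX ε y / mapDeriv T₀ y) x
  - transfer T₀ (fun y => ε y * fderivX w y / mapDeriv T₀ y) x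
  + transfer T₀ (fun y => ε y * fderivX (mapDeriv T₀) y / mapDeriv T₀ y ^ 2 * w y) x

/-- `h = (1 - L)^{-1} g` on the space `V_s` of zero average functions in `W^{1,1}`:
`h ∈ V_s`, `(1 - L) h = g`, and `h = ∑_{i ≥ 0} L^i g` with convergence in `W^{1,1}`
(so that `h` is determined by `g`). -/
structure IsResolventAt (T : X → X) (g h : X → ℝ) : Prop where
  w11 : IsW11 h
  zero_average : ∫ x : X, h x = 0
  solves : ∀ x, h x - transfer T h x = g x
  neumann : TendstoW11
    (fun n : ℕ => fun x => ∑ i ∈ Finset.range n, (transfer T)^[i] g x) atTop h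

end CircleMap

/-! On the universal cover the transfer operator `L` is a finite sum over inverse branches with
weight `1 / F'`. A derivative of `L f` that falls on `f` gains a factor at most `θ < 1`; derivatives
of the weight cost bounded constants. Hence, for large `a`, `L` maps the cone `|f^(j)| ≤ a ^ j * f`
strictly into itself (`strictCone_one`, `exists_strictCone_two`).

A cone function is comparable with its mean (`InCone.le_exp_mul`), so a fixed fraction of the mass
can be removed from `L f` as a constant without leaving the cone (`inCone_sub`). For two cone
functions of equal mass the removed constants cancel in the difference, so what remains decays
geometrically (`exists_iterate_sub`). This is exponential decay in `C^k` on zero-average functions,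
with explicit constants (`ckBound_iterate`). It gives the Neumann series, the `C^2` density, and a
bound for `(1 - L)⁻¹` depending only on the cone (`ckBound_of_sub_liftTransfer`). Uniqueness of the
density is a minimum principle: the zeros of a nonnegative fixed function contain backward orbits
that come arbitrarily close to every point (`eq_zero_of_fixed`).

For linear response, set `w = (f_δ - f_0) / δ - v` with `(1 - L_0) v = L̂ f_0`. Then `(1 - L_δ) w =
((L_δ - L_0) f_0 / δ - L̂ f_0) + (L_δ - L_0) v`. Since `f_0` is `C^2` and `v` is `C^1`, both
brackets tend to `0` in `C^1`. Maps with small `δ > 0` share one `C^1` cone, so `(1 - L_δ)⁻¹` is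
uniformly bounded on zero averages and `w` tends to `0` in `C^1`, hence in `W^{1,1}`. -/

namespace CircleMap

/-! ### Expanding lifts and their transfer operators on the line. -/

/-- `F` is a `C^3` lift to `ℝ` of an expanding circle map of degree `d`. -/
structure ExpandingLift (d : ℕ) (F : ℝ → ℝ) : Prop where
  contDiff : ContDiff ℝ 3 F
  add_one : ∀ t, F (t + 1) = F t + d
  one_lt_deriv : ∀ t, 1 < deriv F t

/-- The inverse of a lift. -/
noncomputable def invLift (F : ℝ → ℝ) : ℝ → ℝ := Function.invFun F

/-- The weight of the transfer operator: the reciprocal of the derivative of the lift. -/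
noncomputable def weight (F : ℝ → ℝ) (t : ℝ) : ℝ := (deriv F t)⁻¹

/-- The sum of `φ` over the inverse branches. -/
noncomputable def branchSum (d : ℕ) (F φ : ℝ → ℝ) (x : ℝ) : ℝ :=
  ∑ i ∈ Finset.range d, φ (invLift F (x + i))

/-- The transfer operator acting on periodic functions on the line. -/
noncomputable def liftTransfer (d : ℕ) (F f : ℝ → ℝ) : ℝ → ℝ :=
  branchSum d F (fun t => f t * weight F t)

theorem branchSum_add (d : ℕ) (F φ ψ : ℝ → ℝ) :
    branchSum d F (fun t => φ t + ψ t) = fun x => branchSum d F φ x + branchSum d F ψ x := by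
  ext x; simp [branchSum, Finset.sum_add_distrib]

theorem branchSum_sub (d : ℕ) (F φ ψ : ℝ → ℝ) :
    branchSum d F (fun t => φ t - ψ t) = fun x => branchSum d F φ x - branchSum d F ψ x := by
  ext x; simp [branchSum, Finset.sum_sub_distrib]

theorem branchSum_const_mul (d : ℕ) (F φ : ℝ → ℝ) (c : ℝ) :
    branchSum d F (fun t => c * φ t) = fun x => c * branchSum d F φ x := by
  ext x; simp [branchSum, Finset.mul_sum]

theorem abs_branchSum_le {d : ℕ} {F φ ψ : ℝ → ℝ} (h : ∀ t, |φ t| ≤ ψ t) (x : ℝ) :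
    |branchSum d F φ x| ≤ branchSum d F ψ x :=
  (Finset.abs_sum_le_sum_abs _ _).trans (Finset.sum_le_sum fun _ _ => h _)

theorem liftTransfer_add (d : ℕ) (F f g : ℝ → ℝ) :
    liftTransfer d F (fun t => f t + g t)
      = fun x => liftTransfer d F f x + liftTransfer d F g x := by
  simp only [liftTransfer, add_mul, branchSum_add]

theorem liftTransfer_sub (d : ℕ) (F f g : ℝ → ℝ) :
    liftTransfer d F (fun t => f t - g t)
      = fun x => liftTransfer d F f x - liftTransfer d F g x := by
  simp only [liftTransfer, sub_mul, branchSum_sub]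

theorem liftTransfer_const_mul (d : ℕ) (F f : ℝ → ℝ) (c : ℝ) :
    liftTransfer d F (fun t => c * f t) = fun x => c * liftTransfer d F f x := by
  simp only [liftTransfer, mul_assoc, branchSum_const_mul]

namespace ExpandingLift

variable {d : ℕ} {F : ℝ → ℝ}

theorem hasDerivAt (hF : ExpandingLift d F) (t : ℝ) : HasDerivAt F (deriv F t) t :=
  (hF.contDiff.differentiable (by norm_num) t).hasDerivAt

theorem strictMono (hF : ExpandingLift d F) : StrictMono F :=
  strictMono_of_deriv_pos fun t => one_pos.trans (hF.one_lt_deriv t)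

theorem surjective (hF : ExpandingLift d F) : Function.Surjective F := by
  -- Since `F' > 1`, the difference `F t - t` is monotone, so `F` is compared with `F 0 + t` at both
  -- ends of the line.
  have hm : Monotone fun t => F t - t := by
    refine monotone_of_deriv_nonneg
      ((hF.contDiff.differentiable (by norm_num)).sub differentiable_id) fun t => ?_
    have := ((hF.hasDerivAt t).sub (hasDerivAt_id t)).deriv
    have h1 := hF.one_lt_deriv t
    have h2 : deriv (fun t => F t - t) t = deriv F t - 1 := this
    rw [h2]; linarith
  refine hF.contDiff.continuous.surjective ?_ ?_
  · refine tendsto_atTop_mono' _ ?_ (tendsto_atTop_add_const_left _ (F 0) tendsto_id)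
    filter_upwards [eventually_ge_atTop 0] with t ht
    have := hm ht
    simp only [id] at *; linarith
  · refine tendsto_atBot_mono' _ ?_ (tendsto_atBot_add_const_left _ (F 0) tendsto_id)
    filter_upwards [eventually_le_atBot 0] with t ht
    have := hm ht
    simp only [id] at *; linarith

theorem apply_invLift (hF : ExpandingLift d F) (x : ℝ) : F (invLift F x) = x :=
  Function.rightInverse_invFun hF.surjective x

theorem invLift_apply (hF : ExpandingLift d F) (t : ℝ) : invLift F (F t) = t :=
  Function.leftInverse_invFun hF.strictMono.injective t

theorem invLift_add (hF : ExpandingLift d F) (x : ℝ) : invLift F (x + d) = invLift F x + 1 := by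
  apply hF.strictMono.injective
  rw [hF.apply_invLift, hF.add_one, hF.apply_invLift]

theorem invLift_strictMono (hF : ExpandingLift d F) : StrictMono (invLift F) := fun x y h => by
  rw [← hF.strictMono.lt_iff_lt, hF.apply_invLift, hF.apply_invLift]; exact h

theorem invLift_continuous (hF : ExpandingLift d F) : Continuous (invLift F) :=
  hF.invLift_strictMono.monotone.continuous_of_surjective
    fun t => ⟨F t, hF.invLift_apply t⟩

theorem deriv_pos (hF : ExpandingLift d F) (t : ℝ) : 0 < deriv F t :=
  one_pos.trans (hF.one_lt_deriv t)

theorem hasDerivAt_invLift (hF : ExpandingLift d F) (x : ℝ) :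
    HasDerivAt (invLift F) (weight F (invLift F x)) x :=
  HasDerivAt.of_local_left_inverse hF.invLift_continuous.continuousAt
    (hF.hasDerivAt (invLift F x)) (hF.deriv_pos _).ne'
    (Eventually.of_forall hF.apply_invLift)

theorem degree_pos (hF : ExpandingLift d F) : 0 < d := by
  rcases Nat.eq_zero_or_pos d with h | h
  · have h1 := hF.add_one 0
    have h2 := hF.strictMono (show (0 : ℝ) < 0 + 1 by norm_num)
    subst h; simp at *; linarith
  · exact h

theorem deriv_periodic (hF : ExpandingLift d F) : Function.Periodic (deriv F) 1 := fun t => by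
  have h1 := ((hF.hasDerivAt (t + 1)).comp_add_const t 1)
  have h2 : (fun t => F (t + 1)) = fun t => F t + d := funext hF.add_one
  rw [h2] at h1
  exact h1.unique ((hF.hasDerivAt t).add_const _)

theorem weight_periodic (hF : ExpandingLift d F) : Function.Periodic (weight F) 1 := fun t => by
  simp only [weight, hF.deriv_periodic t]

theorem weight_pos (hF : ExpandingLift d F) (t : ℝ) : 0 < weight F t :=
  inv_pos.2 (hF.deriv_pos t)

theorem weight_lt_one (hF : ExpandingLift d F) (t : ℝ) : weight F t < 1 :=
  inv_lt_one_of_one_lt₀ (hF.one_lt_deriv t)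

theorem contDiff_deriv (hF : ExpandingLift d F) : ContDiff ℝ 2 (deriv F) :=
  (contDiff_succ_iff_deriv.1 (show ContDiff ℝ (2 + 1) F from hF.contDiff)).2.2

theorem contDiff_weight (hF : ExpandingLift d F) : ContDiff ℝ 2 (weight F) :=
  hF.contDiff_deriv.inv fun t => (hF.deriv_pos t).ne'

theorem hasDerivAt_weight (hF : ExpandingLift d F) (t : ℝ) :
    HasDerivAt (weight F) (deriv (weight F) t) t :=
  (hF.contDiff_weight.differentiable (by norm_num) t).hasDerivAt

theorem deriv_weight (hF : ExpandingLift d F) (t : ℝ) :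
    deriv (weight F) t = -(deriv (deriv F) t) * weight F t ^ 2 := by
  have h1 := (hF.contDiff_deriv.differentiable (by norm_num) t).hasDerivAt
  have h2 := (h1.inv (hF.deriv_pos t).ne').deriv
  have h3 : deriv (weight F) t = deriv (deriv F)⁻¹ t := rfl
  rw [h3, h2, weight, div_eq_mul_inv, inv_pow]

/-- Translating `x` by `1` shifts the branch index. The term that enters, `i = d`, equals the one
that leaves, `i = 0`, because `invLift F (x + d) = invLift F x + 1`. -/
theorem branchSum_periodic (hF : ExpandingLift d F) {φ : ℝ → ℝ} (hφ : Function.Periodic φ 1) :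
    Function.Periodic (branchSum d F φ) 1 := fun x => by
  have h1 : branchSum d F φ (x + 1) = ∑ i ∈ Finset.range d, φ (invLift F (x + (i + 1 : ℕ))) := by
    refine Finset.sum_congr rfl fun i _ => ?_
    push_cast; congr 2; ring
  rw [h1]
  have h2 := Finset.sum_range_succ (fun i : ℕ => φ (invLift F (x + i))) d
  have h3 := Finset.sum_range_succ' (fun i : ℕ => φ (invLift F (x + i))) d
  rw [h2, hF.invLift_add, hφ] at h3
  simp only [Nat.cast_zero, add_zero, add_left_inj] at h3
  exact h3.symm

theorem liftTransfer_periodic (hF : ExpandingLift d F) {f : ℝ → ℝ}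
    (hf : Function.Periodic f 1) : Function.Periodic (liftTransfer d F f) 1 :=
  hF.branchSum_periodic fun t => by simp only [hf t, hF.weight_periodic t]

/-- Each derivative of a branch sum brings out one more factor `weight F < 1`; this is the source of
all contraction below. -/
theorem hasDerivAt_branchSum (hF : ExpandingLift d F) {φ φ' : ℝ → ℝ}
    (hφ : ∀ t, HasDerivAt φ (φ' t) t) (x : ℝ) :
    HasDerivAt (branchSum d F φ) (branchSum d F (fun t => φ' t * weight F t) x) x := by
  refine HasDerivAt.fun_sum fun i _ => ?_
  have h := (hF.hasDerivAt_invLift (x + i)).comp_add_const x i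
  exact (hφ _).comp x h

theorem continuous_branchSum (hF : ExpandingLift d F) {φ : ℝ → ℝ} (hφ : Continuous φ) :
    Continuous (branchSum d F φ) :=
  continuous_finsetSum _ fun _ _ =>
    hφ.comp (hF.invLift_continuous.comp (continuous_id.add continuous_const))

theorem continuous_weight (hF : ExpandingLift d F) : Continuous (weight F) :=
  hF.contDiff_weight.continuous

theorem continuous_liftTransfer (hF : ExpandingLift d F) {f : ℝ → ℝ} (hf : Continuous f) :
    Continuous (liftTransfer d F f) :=
  hF.continuous_branchSum (hf.mul hF.continuous_weight)

theorem deriv_branchSum (hF : ExpandingLift d F) {φ : ℝ → ℝ} (hφ : ContDiff ℝ 1 φ) :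
    deriv (branchSum d F φ) = branchSum d F (fun t => deriv φ t * weight F t) :=
  funext fun x => (hF.hasDerivAt_branchSum
    (fun t => (hφ.differentiable (by norm_num) t).hasDerivAt) x).deriv

theorem contDiff_branchSum_one (hF : ExpandingLift d F) {φ : ℝ → ℝ} (hφ : ContDiff ℝ 1 φ) :
    ContDiff ℝ 1 (branchSum d F φ) := by
  rw [contDiff_one_iff_deriv, hF.deriv_branchSum hφ]
  exact ⟨fun x => (hF.hasDerivAt_branchSum
    (fun t => (hφ.differentiable (by norm_num) t).hasDerivAt) x).differentiableAt,
    hF.continuous_branchSum ((hφ.continuous_deriv le_rfl).mul hF.continuous_weight)⟩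

theorem contDiff_branchSum_two (hF : ExpandingLift d F) {φ : ℝ → ℝ} (hφ : ContDiff ℝ 2 φ) :
    ContDiff ℝ 2 (branchSum d F φ) := by
  have h1 : ContDiff ℝ 1 φ := hφ.of_le (by norm_num)
  have h2 : ContDiff ℝ 1 (deriv φ) :=
    (contDiff_succ_iff_deriv.1 (show ContDiff ℝ (1 + 1) φ from hφ)).2.2
  refine (contDiff_succ_iff_deriv (n := 1)).2
    ⟨(hF.contDiff_branchSum_one h1).differentiable (by norm_num), by simp, ?_⟩
  rw [hF.deriv_branchSum h1]
  exact hF.contDiff_branchSum_one (h2.mul (hF.contDiff_weight.of_le (by norm_num)))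

/-- The order stops at `2` because the weight, the reciprocal of the derivative of a `C^3` map, is
only `C^2`. -/
theorem contDiff_liftTransfer (hF : ExpandingLift d F) {k : ℕ} (hk1 : 1 ≤ k) (hk : k ≤ 2)
    {f : ℝ → ℝ} (hf : ContDiff ℝ k f) : ContDiff ℝ k (liftTransfer d F f) := by
  interval_cases k
  · exact hF.contDiff_branchSum_one (hf.mul (hF.contDiff_weight.of_le (by norm_num)))
  · exact hF.contDiff_branchSum_two (hf.mul hF.contDiff_weight)

theorem deriv_liftTransfer (hF : ExpandingLift d F) {f : ℝ → ℝ} (hf : ContDiff ℝ 1 f) :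
    deriv (liftTransfer d F f) = branchSum d F
      (fun t => (deriv f t * weight F t + f t * deriv (weight F) t) * weight F t) :=
  funext fun x => (hF.hasDerivAt_branchSum (fun t =>
    (hf.differentiable (by norm_num) t).hasDerivAt.mul (hF.hasDerivAt_weight t)) x).deriv

theorem deriv_deriv_liftTransfer (hF : ExpandingLift d F) {f : ℝ → ℝ} (hf : ContDiff ℝ 2 f) :
    deriv (deriv (liftTransfer d F f)) = branchSum d F
      (fun t => (deriv (deriv f) t * weight F t ^ 2 + 3 * deriv f t * weight F t
        * deriv (weight F) t + f t * (weight F t * deriv (deriv (weight F)) t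
        + deriv (weight F) t ^ 2)) * weight F t) := by
  rw [hF.deriv_liftTransfer (hf.of_le (by norm_num))]
  have hd : ∀ {g : ℝ → ℝ}, ContDiff ℝ 2 g → ∀ t, HasDerivAt (deriv g) (deriv (deriv g) t) t :=
    fun {g} hg t => ((contDiff_succ_iff_deriv.1
      (show ContDiff ℝ (1 + 1) g from hg)).2.2.differentiable (by norm_num) t).hasDerivAt
  have hf1 := fun t => (hf.differentiable (by norm_num) t).hasDerivAt
  funext x
  refine (hF.hasDerivAt_branchSum (fun t => (((hd hf t).mul (hF.hasDerivAt_weight t)).add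
    ((hf1 t).mul (hd hF.contDiff_weight t))).mul (hF.hasDerivAt_weight t)) x).deriv.trans ?_
  congr 1
  funext t
  simp only [Pi.add_apply, Pi.mul_apply]
  ring

theorem liftTransfer_nonneg (hF : ExpandingLift d F) {f : ℝ → ℝ} (hf : ∀ t, 0 ≤ f t) (t : ℝ) :
    0 ≤ liftTransfer d F f t := by
  unfold liftTransfer branchSum
  refine Finset.sum_nonneg fun i _ => ?_
  exact mul_nonneg (hf _) (hF.weight_pos _).le

/-- The duality between the transfer operator and composition. -/
theorem integral_mul_liftTransfer (hF : ExpandingLift d F) {f ψ : ℝ → ℝ} (hf : Continuous f)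
    (hψ : Continuous ψ) (hfp : Function.Periodic f 1) (hψp : Function.Periodic ψ 1) :
    ∫ x in (0 : ℝ)..1, ψ x * liftTransfer d F f x = ∫ t in (0 : ℝ)..1, ψ (F t) * f t := by
  have hψn : ∀ (i : ℕ) x, ψ (x + i) = ψ x := fun i x => by simpa using hψp.nat_mul i x
  have hG := hF.invLift_continuous
  have hc : Continuous fun x => ψ x * (f (invLift F x) * weight F (invLift F x)) :=
    hψ.mul ((hf.comp hG).mul (hF.continuous_weight.comp hG))
  have h1 : ∀ x, ψ x * liftTransfer d F f x = ∑ i ∈ Finset.range d,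
      ψ (x + i) * (f (invLift F (x + i)) * weight F (invLift F (x + i))) := fun x => by
    simp only [liftTransfer, branchSum, Finset.mul_sum, hψn]
  simp only [h1]
  have hci : ∀ i : ℕ, Continuous fun x : ℝ =>
      ψ (x + i) * (f (invLift F (x + i)) * weight F (invLift F (x + i))) := fun i =>
    hc.comp (continuous_id.add continuous_const)
  rw [intervalIntegral.integral_finsetSum fun i _ => (hci i).intervalIntegrable _ _]
  -- Branch `i` contributes the integral over `[i, i + 1]`. Together they fill `[0, d]`, which the
  -- substitution `t = invLift F x` carries onto one period.
  have h2 : ∀ i : ℕ, ∫ x in (0 : ℝ)..1,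
      ψ (x + i) * (f (invLift F (x + i)) * weight F (invLift F (x + i)))
      = ∫ x in ((i : ℕ) : ℝ)..((i + 1 : ℕ) : ℝ),
        ψ x * (f (invLift F x) * weight F (invLift F x)) := fun i => by
    rw [intervalIntegral.integral_comp_add_right
      (fun x => ψ x * (f (invLift F x) * weight F (invLift F x)))]
    push_cast; congr 1 <;> ring
  simp only [h2]
  rw [intervalIntegral.sum_integral_adjacent_intervals fun i _ => hc.intervalIntegrable _ _]
  have hψF : Continuous fun t => ψ (F t) * f t := (hψ.comp hF.contDiff.continuous).mul hf
  have h3 := intervalIntegral.integral_comp_mul_deriv (a := ((0 : ℕ) : ℝ)) (b := d)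
    (fun x _ => hF.hasDerivAt_invLift x)
    (hF.continuous_weight.comp hG).continuousOn hψF
  have h4 : invLift F (d : ℝ) = invLift F 0 + 1 := by simpa using hF.invLift_add 0
  have hper : Function.Periodic (fun t => ψ (F t) * f t) 1 := fun t => by
    simp only [hF.add_one, hψn, hfp t]
  rw [h4, Nat.cast_zero] at h3
  have h5 := hper.intervalIntegral_add_eq (invLift F 0) 0
  rw [zero_add] at h5
  rw [← h5, ← h3, Nat.cast_zero]
  refine intervalIntegral.integral_congr fun x _ => ?_
  simp only [Function.comp, hF.apply_invLift]
  ring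

theorem integral_liftTransfer (hF : ExpandingLift d F) {f : ℝ → ℝ} (hf : Continuous f)
    (hfp : Function.Periodic f 1) :
    ∫ x in (0 : ℝ)..1, liftTransfer d F f x = ∫ t in (0 : ℝ)..1, f t := by
  simpa using hF.integral_mul_liftTransfer (ψ := fun _ => 1) hf continuous_const hfp
    fun _ => rfl

end ExpandingLift

end CircleMap

/-! ### Bounds in `C^k`, cones, and exponential decay on zero averages. -/

namespace CircleMap

/-- `f` is a `1`-periodic function of class `C^k`. -/
structure PeriodicCk (k : ℕ) (f : ℝ → ℝ) : Prop where
  contDiff : ContDiff ℝ k f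
  periodic : Function.Periodic f 1

/-- All derivatives of `f` of order at most `k` are bounded by `M`. -/
def CkBound (k : ℕ) (M : ℝ) (f : ℝ → ℝ) : Prop :=
  ∀ j ≤ k, ∀ t, |iteratedDeriv j f t| ≤ M

/-- The cone of periodic functions with `|f^(j)| ≤ a^j f` for `j ≤ k`. -/
structure InCone (k : ℕ) (a : ℝ) (f : ℝ → ℝ) : Prop extends PeriodicCk k f where
  bound : ∀ j ≤ k, ∀ t, |iteratedDeriv j f t| ≤ a ^ j * f t

namespace PeriodicCk

variable {k : ℕ} {f g : ℝ → ℝ}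

theorem add (hf : PeriodicCk k f) (hg : PeriodicCk k g) : PeriodicCk k fun t => f t + g t :=
  ⟨hf.contDiff.add hg.contDiff, fun t => by simp only [hf.periodic t, hg.periodic t]⟩

theorem sub (hf : PeriodicCk k f) (hg : PeriodicCk k g) : PeriodicCk k fun t => f t - g t :=
  ⟨hf.contDiff.sub hg.contDiff, fun t => by simp only [hf.periodic t, hg.periodic t]⟩

theorem const (c : ℝ) : PeriodicCk k fun _ => c := ⟨contDiff_const, fun _ => rfl⟩

theorem const_mul (c : ℝ) (hf : PeriodicCk k f) : PeriodicCk k fun t => c * f t :=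
  ⟨contDiff_const.mul hf.contDiff, fun t => by simp only [hf.periodic t]⟩

theorem continuous (hf : PeriodicCk k f) : Continuous f := hf.contDiff.continuous

theorem of_le {l : ℕ} (hf : PeriodicCk k f) (h : l ≤ k) : PeriodicCk l f :=
  ⟨hf.contDiff.of_le (by exact_mod_cast h), hf.periodic⟩

theorem sum {ι : Type*} {u : ι → ℝ → ℝ} (s : Finset ι) (h : ∀ i, PeriodicCk k (u i)) :
    PeriodicCk k fun t => ∑ i ∈ s, u i t :=
  ⟨ContDiff.sum fun i _ => (h i).contDiff,
    fun t => Finset.sum_congr rfl fun i _ => (h i).periodic t⟩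

theorem periodic_iteratedDeriv (hf : PeriodicCk k f) (j : ℕ) :
    Function.Periodic (iteratedDeriv j f) 1 := fun t => by
  have h := iteratedDeriv_comp_add_const j f 1
  rw [show (fun z => f (z + 1)) = f from funext hf.periodic] at h
  exact (congrFun h t).symm

end PeriodicCk

theorem exists_abs_le_of_periodic {f : ℝ → ℝ} (hf : Continuous f)
    (hp : Function.Periodic f 1) : ∃ M, ∀ t, |f t| ≤ M := by
  obtain ⟨M, hM⟩ := (isCompact_Icc (a := (0 : ℝ)) (b := 1)).exists_bound_of_continuousOn
    hf.continuousOn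
  refine ⟨M, fun t => ?_⟩
  obtain ⟨y, hy, h⟩ := hp.exists_mem_Ico₀ one_pos t
  rw [h]
  exact hM y (Ico_subset_Icc_self hy)

theorem PeriodicCk.exists_ckBound {k : ℕ} {f : ℝ → ℝ} (hf : PeriodicCk k f) :
    ∃ M, CkBound k M f := by
  have h : ∀ j : ℕ, ∃ M, j ≤ k → ∀ t, |iteratedDeriv j f t| ≤ M := fun j => by
    by_cases hj : j ≤ k
    · obtain ⟨M, hM⟩ := exists_abs_le_of_periodic
        (hf.contDiff.continuous_iteratedDeriv j (by exact_mod_cast hj))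
        (hf.periodic_iteratedDeriv j)
      exact ⟨M, fun _ => hM⟩
    · exact ⟨0, fun h => absurd h hj⟩
  choose M hM using h
  refine ⟨∑ j ∈ Finset.range (k + 1), |M j|, fun j hj t => ?_⟩
  exact ((hM j hj t).trans (le_abs_self _)).trans
    (Finset.single_le_sum (f := fun j => |M j|) (fun _ _ => abs_nonneg _)
      (Finset.mem_range.2 (by omega)))

namespace CkBound

variable {k : ℕ} {f g : ℝ → ℝ} {M N : ℝ}

theorem abs_le (hf : CkBound k M f) (t : ℝ) : |f t| ≤ M := by
  simpa using hf 0 (Nat.zero_le _) t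

theorem nonneg (hf : CkBound k M f) : 0 ≤ M := (abs_nonneg _).trans (hf.abs_le 0)

theorem mono (hf : CkBound k M f) (h : M ≤ N) : CkBound k N f :=
  fun j hj t => (hf j hj t).trans h

theorem neg (hf : CkBound k M f) : CkBound k M fun t => -f t := fun j hj t => by
  rw [iteratedDeriv_fun_neg, abs_neg]; exact hf j hj t

theorem add (hf : CkBound k M f) (hg : CkBound k N g) (hf' : ContDiff ℝ k f)
    (hg' : ContDiff ℝ k g) : CkBound k (M + N) fun t => f t + g t := fun j hj t => by
  have hjk : (j : WithTop ℕ∞) ≤ k := by exact_mod_cast hj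
  rw [iteratedDeriv_fun_add (hf'.of_le hjk).contDiffAt (hg'.of_le hjk).contDiffAt]
  exact (abs_add_le _ _).trans (add_le_add (hf j hj t) (hg j hj t))

theorem sub (hf : CkBound k M f) (hg : CkBound k N g) (hf' : ContDiff ℝ k f)
    (hg' : ContDiff ℝ k g) : CkBound k (M + N) fun t => f t - g t := by
  simpa only [sub_eq_add_neg] using hf.add hg.neg hf' hg'.neg

theorem sum {u : ℕ → ℝ → ℝ} {v : ℕ → ℝ} (s : Finset ℕ) (hu : ∀ i, CkBound k (v i) (u i))
    (hu' : ∀ i, ContDiff ℝ k (u i)) :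
    CkBound k (∑ i ∈ s, v i) fun t => ∑ i ∈ s, u i t := fun j hj t => by
  have hjk : (j : WithTop ℕ∞) ≤ k := by exact_mod_cast hj
  rw [iteratedDeriv_fun_sum fun i _ => ((hu' i).of_le hjk).contDiffAt]
  exact (Finset.abs_sum_le_sum_abs _ _).trans (Finset.sum_le_sum fun i _ => hu i j hj t)

theorem norm_iteratedFDeriv_le (hf : CkBound k M f) {j : ℕ} (hj : j ≤ k) (t : ℝ) :
    ‖iteratedFDeriv ℝ j f t‖ ≤ M := by
  rw [norm_iteratedFDeriv_eq_norm_iteratedDeriv]; exact hf j hj t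

theorem contDiff_tsum {u : ℕ → ℝ → ℝ} {v : ℕ → ℝ} (hu : ∀ i, CkBound k (v i) (u i))
    (hu' : ∀ i, ContDiff ℝ k (u i)) (hv : Summable v) :
    ContDiff ℝ k fun t => ∑' i, u i t :=
  _root_.contDiff_tsum (N := k) (v := fun _ => v) hu' (fun _ _ => hv)
    fun j i t hj => (hu i).norm_iteratedFDeriv_le (by exact_mod_cast hj) t

theorem tsum {u : ℕ → ℝ → ℝ} {v : ℕ → ℝ} (hu : ∀ i, CkBound k (v i) (u i))
    (hu' : ∀ i, ContDiff ℝ k (u i)) (hv : Summable v) :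
    CkBound k (∑' i, v i) fun t => ∑' i, u i t := fun j hj t => by
  rw [← Real.norm_eq_abs, ← norm_iteratedFDeriv_eq_norm_iteratedDeriv,
    iteratedFDeriv_tsum_apply (N := k) (v := fun _ => v) hu' (fun _ _ => hv)
      (fun j i t hj => (hu i).norm_iteratedFDeriv_le (by exact_mod_cast hj) t)
      (by exact_mod_cast hj)]
  exact tsum_of_norm_bounded hv.hasSum fun i => (hu i).norm_iteratedFDeriv_le hj t

end CkBound

namespace InCone

variable {k : ℕ} {a : ℝ} {f : ℝ → ℝ}

theorem nonneg (hf : InCone k a f) (t : ℝ) : 0 ≤ f t := by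
  have := hf.bound 0 (Nat.zero_le _) t
  simp only [iteratedDeriv_zero, pow_zero, one_mul] at this
  exact (abs_nonneg _).trans this

/-- The Harnack inequality in the cone. -/
theorem le_exp_mul (hf : InCone k a f) (hk : 1 ≤ k) (ha : 0 ≤ a) (x y : ℝ) :
    f x ≤ Real.exp a * f y := by
  have hd : ∀ t, HasDerivAt (fun t => f t * Real.exp (a * t))
      (deriv f t * Real.exp (a * t) + f t * (Real.exp (a * t) * (a * 1))) t := fun t =>
    ((hf.contDiff.differentiable (by exact_mod_cast (by omega : k ≠ 0)) t).hasDerivAt).mul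
      (((hasDerivAt_id t).const_mul a).exp)
  -- The cone condition of order one gives `f' ≥ -a f`, which is monotonicity of `f t * exp (a t)`.
  have hm : Monotone fun t => f t * Real.exp (a * t) := by
    refine monotone_of_deriv_nonneg (fun t => (hd t).differentiableAt) fun t => ?_
    rw [(hd t).deriv]
    have h1 := hf.bound 1 hk t
    rw [iteratedDeriv_one, pow_one] at h1
    have h2 := (abs_le.1 h1).1
    have : 0 ≤ (deriv f t + a * f t) * Real.exp (a * t) :=
      mul_nonneg (by linarith) (Real.exp_pos _).le
    linarith
  -- By periodicity `y` may be replaced by a translate `z` in `[x, x + 1)`, so the exponential costs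
  -- at most `exp a`.
  obtain ⟨z, hz, hzy⟩ := hf.periodic.exists_mem_Ico one_pos y x
  have h1 : f x * Real.exp (a * x) ≤ f z * Real.exp (a * z) := hm hz.1
  have h2 : Real.exp (a * z) ≤ Real.exp a * Real.exp (a * x) := by
    rw [← Real.exp_add]
    refine Real.exp_le_exp.2 ?_
    nlinarith [hz.2]
  have h3 := mul_le_mul_of_nonneg_left h2 (hf.nonneg z)
  rw [hzy]
  refine le_of_mul_le_mul_right ?_ (Real.exp_pos (a * x))
  linarith

theorem exp_neg_mul_integral_le (hf : InCone k a f) (hk : 1 ≤ k) (ha : 0 ≤ a) (t : ℝ) :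
    Real.exp (-a) * ∫ x in (0 : ℝ)..1, f x ≤ f t := by
  have h := intervalIntegral.integral_mono_on (a := (0 : ℝ)) (b := 1) (μ := volume) zero_le_one
    (hf.continuous.intervalIntegrable 0 1)
    (continuous_const.intervalIntegrable 0 1) fun x _ => hf.le_exp_mul hk ha x t
  rw [intervalIntegral.integral_const] at h
  have h2 : Real.exp (-a) * Real.exp a = 1 := by rw [← Real.exp_add]; simp
  have h3 := mul_le_mul_of_nonneg_left h (Real.exp_pos (-a)).le
  simp only [sub_zero, one_smul, ← mul_assoc, h2, one_mul] at h3
  exact h3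

theorem le_exp_mul_integral (hf : InCone k a f) (hk : 1 ≤ k) (ha : 0 ≤ a) (t : ℝ) :
    f t ≤ Real.exp a * ∫ x in (0 : ℝ)..1, f x := by
  have hc : Continuous fun x => Real.exp a * f x := continuous_const.mul hf.continuous
  have h := intervalIntegral.integral_mono_on (a := (0 : ℝ)) (b := 1) (μ := volume) zero_le_one
    (continuous_const.intervalIntegrable 0 1)
    (hc.intervalIntegrable 0 1) fun x _ => hf.le_exp_mul hk ha t x
  rw [intervalIntegral.integral_const, intervalIntegral.integral_const_mul] at h
  simpa using h

/-- In the cone the mass alone controls all derivatives up to order `k`; this turns decay of mass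
into decay in `C^k`. -/
theorem ckBound (hf : InCone k a f) (hk : 1 ≤ k) (ha : 1 ≤ a) :
    CkBound k (a ^ k * (Real.exp a * ∫ x in (0 : ℝ)..1, f x)) f := fun j hj t =>
  (hf.bound j hj t).trans (mul_le_mul (pow_le_pow_right₀ ha hj)
    (hf.le_exp_mul_integral hk (zero_le_one.trans ha) t) (hf.nonneg t)
    (pow_nonneg (zero_le_one.trans ha) _))

theorem const {c : ℝ} (hc : 0 ≤ c) (ha : 0 ≤ a) : InCone k a fun _ => c :=
  ⟨PeriodicCk.const c, fun j _ t => by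
    rw [iteratedDeriv_const]
    split_ifs with h
    · simp [h, abs_of_nonneg hc]
    · simpa using mul_nonneg (pow_nonneg ha _) hc⟩

end InCone

/-! ### Strict cone contraction and its consequences. -/

/-- `F` is an expanding lift whose transfer operator maps the cone strictly inside itself. -/
structure StrictCone (k d : ℕ) (a κ : ℝ) (F : ℝ → ℝ) : Prop extends ExpandingLift d F where
  one_le : 1 ≤ k
  le_two : k ≤ 2
  one_le_a : 1 ≤ a
  κ_nonneg : 0 ≤ κ
  κ_lt_one : κ < 1
  strict : ∀ f, InCone k a f → ∀ j, 1 ≤ j → j ≤ k → ∀ t,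
    |iteratedDeriv j (liftTransfer d F f) t| ≤ κ * a ^ j * liftTransfer d F f t

/-- The fraction of mass absorbed at each step. -/
noncomputable def coneGap (a κ : ℝ) : ℝ := (1 - κ) * Real.exp (-a)

namespace StrictCone

variable {k d : ℕ} {a κ : ℝ} {F : ℝ → ℝ}

theorem coneGap_pos (h : StrictCone k d a κ F) : 0 < coneGap a κ :=
  mul_pos (by linarith [h.κ_lt_one]) (Real.exp_pos _)

theorem coneGap_lt_one (h : StrictCone k d a κ F) : coneGap a κ < 1 := by
  have h1 : Real.exp (-a) < 1 := Real.exp_lt_one_iff.2 (by linarith [h.one_le_a])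
  have h2 := Real.exp_pos (-a)
  unfold coneGap
  nlinarith [h.κ_nonneg, h.κ_lt_one]

theorem a_nonneg (h : StrictCone k d a κ F) : 0 ≤ a := zero_le_one.trans h.one_le_a

theorem periodicCk_liftTransfer (h : StrictCone k d a κ F) {f : ℝ → ℝ} (hf : PeriodicCk k f) :
    PeriodicCk k (liftTransfer d F f) :=
  ⟨h.contDiff_liftTransfer h.one_le h.le_two hf.contDiff, h.liftTransfer_periodic hf.periodic⟩

theorem periodicCk_iterate (h : StrictCone k d a κ F) {f : ℝ → ℝ} (hf : PeriodicCk k f)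
    (n : ℕ) : PeriodicCk k ((liftTransfer d F)^[n] f) := by
  induction n with
  | zero => exact hf
  | succ n ih => rw [Function.iterate_succ_apply']; exact h.periodicCk_liftTransfer ih

theorem integral_iterate (h : StrictCone k d a κ F) {f : ℝ → ℝ} (hf : PeriodicCk k f)
    (n : ℕ) : ∫ t in (0 : ℝ)..1, (liftTransfer d F)^[n] f t = ∫ t in (0 : ℝ)..1, f t := by
  induction n with
  | zero => rfl
  | succ n ih =>
    have h1 := h.periodicCk_iterate hf n
    rw [Function.iterate_succ_apply', h.integral_liftTransfer h1.continuous h1.periodic, ih]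

theorem inCone_liftTransfer (h : StrictCone k d a κ F) {f : ℝ → ℝ} (hf : InCone k a f) :
    InCone k a (liftTransfer d F f) := by
  have hn := h.liftTransfer_nonneg hf.nonneg
  refine ⟨h.periodicCk_liftTransfer hf.toPeriodicCk, fun j hj t => ?_⟩
  rcases Nat.eq_zero_or_pos j with rfl | hj0
  · simp [abs_of_nonneg (hn t)]
  · refine (h.strict f hf j hj0 hj t).trans ?_
    refine mul_le_mul_of_nonneg_right ?_ (hn t)
    have := pow_nonneg h.a_nonneg j
    nlinarith [h.κ_lt_one]

/-- Subtracting a fixed fraction of the mass from the image stays in the cone. -/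
theorem inCone_sub (h : StrictCone k d a κ F) {f : ℝ → ℝ} (hf : InCone k a f) :
    InCone k a fun t => liftTransfer d F f t - coneGap a κ * ∫ x in (0 : ℝ)..1, f x := by
  have hL := h.inCone_liftTransfer hf
  have hI := h.integral_liftTransfer hf.continuous hf.periodic
  -- Subtracting a constant leaves the derivatives unchanged, and strictness leaves room `(1 - κ) L
  -- f` in the cone condition. By Harnack this is at least `(1 - κ) * exp (-a)` times the mass.
  have key : ∀ t, coneGap a κ * ∫ x in (0 : ℝ)..1, f x ≤ (1 - κ) * liftTransfer d F f t :=
    fun t => by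
      have h1 := hL.exp_neg_mul_integral_le h.one_le h.a_nonneg t
      rw [hI] at h1
      rw [coneGap, mul_assoc]
      exact mul_le_mul_of_nonneg_left h1 (by linarith [h.κ_lt_one])
  refine ⟨hL.toPeriodicCk.sub (PeriodicCk.const _), fun j hj t => ?_⟩
  have hjk : (j : WithTop ℕ∞) ≤ k := by exact_mod_cast hj
  have hκL := mul_nonneg h.κ_nonneg (hL.nonneg t)
  rcases Nat.eq_zero_or_pos j with rfl | hj0
  · simp only [iteratedDeriv_zero, pow_zero, one_mul]
    rw [abs_of_nonneg]
    nlinarith [key t]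
  · rw [iteratedDeriv_fun_sub (hL.contDiff.of_le hjk).contDiffAt contDiffAt_const,
      iteratedDeriv_const, if_neg hj0.ne', sub_zero]
    refine (h.strict f hf j hj0 hj t).trans ?_
    have := mul_le_mul_of_nonneg_left (key t) (pow_nonneg h.a_nonneg j)
    nlinarith

theorem iterate_sub (d : ℕ) (F f g : ℝ → ℝ) (n : ℕ) :
    (liftTransfer d F)^[n] (fun t => f t - g t)
      = fun t => (liftTransfer d F)^[n] f t - (liftTransfer d F)^[n] g t := by
  induction n with
  | zero => rfl
  | succ n ih => simp only [Function.iterate_succ_apply', ih, liftTransfer_sub]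

/-- A coupling argument: at each step the same constant, `coneGap a κ` times the common mass, is
taken from both images. It cancels in the difference, and the remainders `R`, `S` stay in the cone
with geometrically decreasing mass. -/
theorem exists_iterate_sub (h : StrictCone k d a κ F) {f g : ℝ → ℝ} (hf : InCone k a f)
    (hg : InCone k a g) {I : ℝ} (hfI : ∫ t in (0 : ℝ)..1, f t = I)
    (hgI : ∫ t in (0 : ℝ)..1, g t = I) (n : ℕ) :
    ∃ R S, InCone k a R ∧ InCone k a S ∧
      ∫ t in (0 : ℝ)..1, R t = (1 - coneGap a κ) ^ n * I ∧
      ∫ t in (0 : ℝ)..1, S t = (1 - coneGap a κ) ^ n * I ∧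
      (liftTransfer d F)^[n] (fun t => f t - g t) = fun t => R t - S t := by
  induction n with
  | zero => exact ⟨f, g, hf, hg, by simpa, by simpa, rfl⟩
  | succ n ih =>
    obtain ⟨R, S, hR, hS, hRI, hSI, e⟩ := ih
    have hint : ∀ {Q : ℝ → ℝ}, InCone k a Q →
        ∫ t in (0 : ℝ)..1, Q t = (1 - coneGap a κ) ^ n * I →
        ∫ t in (0 : ℝ)..1, (liftTransfer d F Q t - coneGap a κ * ∫ x in (0 : ℝ)..1, Q x)
          = (1 - coneGap a κ) ^ (n + 1) * I := fun {Q} hQ hI => by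
      rw [intervalIntegral.integral_sub
        ((h.continuous_liftTransfer hQ.continuous).intervalIntegrable _ _)
        (continuous_const.intervalIntegrable _ _),
        h.integral_liftTransfer hQ.continuous hQ.periodic, hI]
      simp only [intervalIntegral.integral_const, sub_zero, one_smul]
      ring
    refine ⟨_, _, h.inCone_sub hR, h.inCone_sub hS, hint hR hRI, hint hS hSI, ?_⟩
    rw [Function.iterate_succ_apply', e, liftTransfer_sub, hRI, hSI]
    funext t; ring

/-- Exponential decay of the iterates on functions of zero average. -/
theorem ckBound_iterate (h : StrictCone k d a κ F) {g : ℝ → ℝ} (hg : PeriodicCk k g)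
    (hg0 : ∫ t in (0 : ℝ)..1, g t = 0) {M : ℝ} (hM : CkBound k M g) (n : ℕ) :
    CkBound k (4 * a ^ k * Real.exp a * M * (1 - coneGap a κ) ^ n)
      ((liftTransfer d F)^[n] g) := by
  have hM0 := hM.nonneg
  -- Write `g` as the difference of `g + 2 * M` and `2 * M`. The first is at least `M`, which
  -- dominates every derivative since `a ≥ 1`; both have mass `2 * M`, whence the factor `4`.
  have hc : InCone k a fun _ => 2 * M := InCone.const (by linarith) h.a_nonneg
  have hgc : InCone k a fun t => g t + 2 * M := by
    refine ⟨hg.add (PeriodicCk.const _), fun j hj t => ?_⟩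
    have h1 := abs_le.1 (hM.abs_le t)
    rcases Nat.eq_zero_or_pos j with rfl | hj0
    · simp only [iteratedDeriv_zero, pow_zero, one_mul]
      rw [abs_of_nonneg (by linarith)]
    · have hjk : (j : WithTop ℕ∞) ≤ k := by exact_mod_cast hj
      rw [iteratedDeriv_fun_add (hg.contDiff.of_le hjk).contDiffAt contDiffAt_const,
        iteratedDeriv_const, if_neg hj0.ne', add_zero]
      refine (hM j hj t).trans ?_
      have := one_le_pow₀ h.one_le_a (n := j)
      nlinarith
  have hI : ∫ t in (0 : ℝ)..1, (g t + 2 * M) = 2 * M := by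
    rw [intervalIntegral.integral_add (hg.continuous.intervalIntegrable _ _)
      (continuous_const.intervalIntegrable _ _), hg0]
    simp
  obtain ⟨R, S, hR, hS, hRI, hSI, e⟩ :=
    h.exists_iterate_sub hgc hc hI (by simp : ∫ t in (0 : ℝ)..1, 2 * M = 2 * M) n
  simp only [add_sub_cancel_right] at e
  rw [e]
  have hb := (hR.ckBound h.one_le h.one_le_a).sub (hS.ckBound h.one_le h.one_le_a)
    hR.contDiff hS.contDiff
  rw [hRI, hSI] at hb
  exact hb.mono (le_of_eq (by ring))

theorem summable_rate (h : StrictCone k d a κ F) : Summable fun n => (1 - coneGap a κ) ^ n :=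
  summable_geometric_of_lt_one (by linarith [h.coneGap_lt_one]) (by linarith [h.coneGap_pos])

theorem tsum_rate (h : StrictCone k d a κ F) :
    ∑' n : ℕ, (1 - coneGap a κ) ^ n = (coneGap a κ)⁻¹ := by
  rw [tsum_geometric_of_lt_one (by linarith [h.coneGap_lt_one]) (by linarith [h.coneGap_pos]),
    sub_sub_cancel]

/-- The Neumann series on functions of zero average. -/
theorem exists_resolvent (h : StrictCone k d a κ F) {g : ℝ → ℝ} (hg : PeriodicCk k g)
    (hg0 : ∫ t in (0 : ℝ)..1, g t = 0) :
    ∃ v, PeriodicCk k v ∧ ∫ t in (0 : ℝ)..1, v t = 0 ∧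
      (∀ t, v t - liftTransfer d F v t = g t) ∧
      (∃ b : ℕ → ℝ, Tendsto b atTop (𝓝 0) ∧ ∀ n,
        CkBound k (b n) fun t => ∑ i ∈ Finset.range n, (liftTransfer d F)^[i] g t - v t) := by
  obtain ⟨M, hM⟩ := hg.exists_ckBound
  set C := 4 * a ^ k * Real.exp a * M with hC
  set r := 1 - coneGap a κ with hr
  set u : ℕ → ℝ → ℝ := fun n => (liftTransfer d F)^[n] g with hu
  have hub : ∀ n, CkBound k (C * r ^ n) (u n) := fun n => h.ckBound_iterate hg hg0 hM n
  have hup : ∀ n, PeriodicCk k (u n) := fun n => h.periodicCk_iterate hg n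
  have huc := fun n => (hup n).contDiff
  have hv : Summable fun n => C * r ^ n := h.summable_rate.mul_left C
  have hsum : ∀ t, Summable fun n => u n t := fun t =>
    Summable.of_norm_bounded hv fun n => (hub n).abs_le t
  have hper : PeriodicCk k fun t => ∑' n, u n t :=
    ⟨CkBound.contDiff_tsum hub huc hv, fun t => tsum_congr fun n => (hup n).periodic t⟩
  have htail : ∀ n, CkBound k (∑' i, C * r ^ (i + n))
      fun t => ∑ i ∈ Finset.range n, u i t - ∑' i, u i t := fun n => by
    have h1 := (CkBound.tsum (fun i => hub (i + n)) (fun i => huc (i + n))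
      ((summable_nat_add_iff n).2 hv)).neg
    convert h1 using 2 with t
    rw [← (hsum t).sum_add_tsum_nat_add n]; ring
  have hb : Tendsto (fun n => ∑' i, C * r ^ (i + n)) atTop (𝓝 0) :=
    tendsto_sum_nat_add fun n => C * r ^ n
  refine ⟨fun t => ∑' n, u n t, hper, ?_, fun t => ?_, _, hb, htail⟩
  -- The partial sums have zero average, so the average of the limit is bounded by the tails.
  · have hi : ∀ n, |∫ t in (0 : ℝ)..1, ∑' i, u i t| ≤ ∑' i, C * r ^ (i + n) := fun n => by
      have h1 : ∫ t in (0 : ℝ)..1, ∑ i ∈ Finset.range n, u i t = 0 := by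
        rw [intervalIntegral.integral_finsetSum fun i _ =>
          (hup i).continuous.intervalIntegrable _ _]
        exact Finset.sum_eq_zero fun i _ => (h.integral_iterate hg i).trans hg0
      have h2 : ∫ t in (0 : ℝ)..1, (∑ i ∈ Finset.range n, u i t - ∑' i, u i t)
          = -∫ t in (0 : ℝ)..1, ∑' i, u i t := by
        rw [intervalIntegral.integral_sub
          ((PeriodicCk.sum _ hup).continuous.intervalIntegrable _ _)
          (hper.continuous.intervalIntegrable _ _), h1, zero_sub]
      rw [← abs_neg, ← h2]
      simpa using intervalIntegral.norm_integral_le_of_norm_le_const (a := (0 : ℝ)) (b := 1)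
        (f := fun t => ∑ i ∈ Finset.range n, u i t - ∑' i, u i t) fun t _ => (htail n).abs_le t
    exact abs_nonpos_iff.1 (ge_of_tendsto' hb hi)
  -- The operator passes through the series because it is a finite sum over branches; it then shifts
  -- the index.
  · have h1 : liftTransfer d F (fun t => ∑' n, u n t) t = ∑' n, u (n + 1) t := by
      have h2 : ∀ n, u (n + 1) = liftTransfer d F (u n) := fun n =>
        Function.iterate_succ_apply' _ _ _
      simp only [h2, liftTransfer, branchSum]
      rw [Summable.tsum_finsetSum fun i _ => (hsum _).mul_right _]
      exact Finset.sum_congr rfl fun i _ => tsum_mul_right.symm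
    rw [h1]
    simp only [(hsum t).tsum_eq_zero_add]
    simp [hu]

/-- A bound on the inverse of `1 - L` on functions of zero average. -/
theorem ckBound_of_sub_liftTransfer (h : StrictCone k d a κ F) {v : ℝ → ℝ}
    (hv : PeriodicCk k v) (hv0 : ∫ t in (0 : ℝ)..1, v t = 0) {M : ℝ}
    (hM : CkBound k M fun t => v t - liftTransfer d F v t) :
    CkBound k (4 * a ^ k * Real.exp a * M * (coneGap a κ)⁻¹) v := by
  obtain ⟨N, hN⟩ := hv.exists_ckBound
  set g : ℝ → ℝ := fun t => v t - liftTransfer d F v t with hgdef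
  have hg : PeriodicCk k g := hv.sub (h.periodicCk_liftTransfer hv)
  have hg0 : ∫ t in (0 : ℝ)..1, g t = 0 := by
    rw [intervalIntegral.integral_sub (hv.continuous.intervalIntegrable _ _)
      ((h.continuous_liftTransfer hv.continuous).intervalIntegrable _ _),
      h.integral_liftTransfer hv.continuous hv.periodic, sub_self]
  set C := 4 * a ^ k * Real.exp a with hC
  have hC0 : 0 ≤ C := by have := pow_nonneg h.a_nonneg k; positivity
  set r := 1 - coneGap a κ with hr
  have hr0 : 0 ≤ r := by linarith [h.coneGap_lt_one]
  -- Telescoping `g = v - L v`. The a priori bound `N` of `v` enters only through `L^n v`, which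
  -- vanishes in the limit, so the final bound depends on `M` and the cone alone.
  have htel : ∀ n t, ∑ i ∈ Finset.range n, (liftTransfer d F)^[i] g t
      + (liftTransfer d F)^[n] v t = v t := fun n t => by
    induction n with
    | zero => simp
    | succ n ih =>
      rw [Finset.sum_range_succ, hgdef, iterate_sub, Function.iterate_succ_apply, ← ih]
      ring
  intro j hj t
  have hbound : ∀ n : ℕ, |iteratedDeriv j v t| ≤ C * M * (coneGap a κ)⁻¹ + C * N * r ^ n :=
    fun n => by
      have h1 := (CkBound.sum (Finset.range n) (h.ckBound_iterate hg hg0 hM)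
        fun i => (h.periodicCk_iterate hg i).contDiff).add (h.ckBound_iterate hv hv0 hN n)
        (PeriodicCk.sum _ (h.periodicCk_iterate hg)).contDiff (h.periodicCk_iterate hv n).contDiff
      rw [show (fun t => ∑ i ∈ Finset.range n, (liftTransfer d F)^[i] g t
        + (liftTransfer d F)^[n] v t) = v from funext (htel n), ← Finset.mul_sum] at h1
      refine (h1 j hj t).trans (add_le_add_left ?_ _)
      refine mul_le_mul_of_nonneg_left ?_ (mul_nonneg hC0 hM.nonneg)
      rw [← h.tsum_rate]
      exact h.summable_rate.sum_le_tsum _ fun i _ => pow_nonneg hr0 i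
  have hlim : Tendsto (fun n : ℕ => C * M * (coneGap a κ)⁻¹ + C * N * r ^ n) atTop
      (𝓝 (C * M * (coneGap a κ)⁻¹ + C * N * 0)) :=
    ((tendsto_pow_atTop_nhds_zero_of_lt_one hr0 (by linarith [h.coneGap_pos])).const_mul
      _).const_add _
  rw [mul_zero, add_zero] at hlim
  exact ge_of_tendsto' hlim hbound

end StrictCone

end CircleMap

/-! ### Strict cones for expanding lifts, and the invariant density. -/

namespace CircleMap

/-- The opening of the `C^1` cone for weights bounded by `θ`, with derivative bounded by `K`. -/
noncomputable def coneConst (θ K : ℝ) : ℝ := 2 * (K + 1) / (1 - θ)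

theorem one_le_coneConst {θ K : ℝ} (h0 : 0 ≤ θ) (h1 : θ < 1) (hK : 0 ≤ K) :
    1 ≤ coneConst θ K := by
  rw [coneConst, le_div_iff₀ (by linarith)]; linarith

/-- The constant is tuned so that `θ * a + K ≤ (1 + θ) / 2 * a`: half of the expansion gap absorbs
the distortion `K`. -/
theorem coneConst_mul {θ K : ℝ} (h1 : θ < 1) : (1 - θ) * coneConst θ K = 2 * (K + 1) := by
  have : 1 - θ ≠ 0 := by linarith
  rw [coneConst]; field_simp

theorem abs_branchSum_le_mul {d : ℕ} {F u v : ℝ → ℝ} {c : ℝ}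
    (h : ∀ t, |u t| ≤ c * v t) (x : ℝ) :
    |branchSum d F u x| ≤ c * branchSum d F v x := by
  have := abs_branchSum_le (d := d) (F := F) h x
  rwa [branchSum_const_mul] at this

namespace ExpandingLift

variable {d : ℕ} {F : ℝ → ℝ}

/-- A pointwise Lasota–Yorke inequality: the derivative contracts by `θ` when it falls on `f` and
costs `K` when it falls on the weight. -/
theorem abs_deriv_liftTransfer_le (hF : ExpandingLift d F) {k : ℕ} (hk : 1 ≤ k) {a θ K : ℝ}
    (hθ : ∀ t, weight F t ≤ θ) (hK : ∀ t, |deriv (weight F) t| ≤ K) (ha : 0 ≤ a)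
    {f : ℝ → ℝ} (hf : InCone k a f) (x : ℝ) :
    |deriv (liftTransfer d F f) x| ≤ (θ * a + K) * liftTransfer d F f x := by
  rw [hF.deriv_liftTransfer (hf.contDiff.of_le (by exact_mod_cast hk))]
  refine abs_branchSum_le_mul (fun t => ?_) x
  have hw := hF.weight_pos t
  have hfn := hf.nonneg t
  have h1 := hf.bound 1 hk t
  rw [iteratedDeriv_one, pow_one] at h1
  rw [abs_mul, abs_of_pos hw, ← mul_assoc]
  refine mul_le_mul_of_nonneg_right ?_ hw.le
  refine (abs_add_le _ _).trans ?_
  rw [abs_mul, abs_mul, abs_of_pos hw, abs_of_nonneg hfn]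
  have h2 : |deriv f t| * weight F t ≤ a * f t * θ :=
    mul_le_mul h1 (hθ t) hw.le (mul_nonneg ha hfn)
  have h3 := mul_le_mul_of_nonneg_left (hK t) hfn
  linarith

/-- The cone depends only on `θ` and `K`, so it serves all maps satisfying the same two bounds. -/
theorem strictCone_one (hF : ExpandingLift d F) {θ K : ℝ} (hθ : ∀ t, weight F t ≤ θ)
    (hθ1 : θ < 1) (hK : ∀ t, |deriv (weight F) t| ≤ K) :
    StrictCone 1 d (coneConst θ K) ((1 + θ) / 2) F := by
  have hθ0 : 0 ≤ θ := (hF.weight_pos 0).le.trans (hθ 0)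
  have hK0 : 0 ≤ K := (abs_nonneg _).trans (hK 0)
  have ha := one_le_coneConst hθ0 hθ1 hK0
  refine ⟨hF, le_rfl, by norm_num, ha, by linarith, by linarith, fun f hf j hj0 hj1 t => ?_⟩
  obtain rfl : j = 1 := le_antisymm hj1 hj0
  rw [iteratedDeriv_one, pow_one]
  refine (hF.abs_deriv_liftTransfer_le le_rfl hθ hK (by linarith) hf t).trans
    (mul_le_mul_of_nonneg_right ?_ (hF.liftTransfer_nonneg hf.nonneg t))
  linarith [coneConst_mul (K := K) hθ1]

theorem exists_weight_le (hF : ExpandingLift d F) : ∃ θ < 1, ∀ t, weight F t ≤ θ := by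
  obtain ⟨x, -, hx⟩ := (isCompact_Icc (a := (0 : ℝ)) (b := 1)).exists_isMaxOn
    ⟨0, by simp⟩ hF.continuous_weight.continuousOn
  refine ⟨weight F x, hF.weight_lt_one x, fun t => ?_⟩
  obtain ⟨y, hy, h⟩ := hF.weight_periodic.exists_mem_Ico₀ one_pos t
  rw [h]
  exact hx (Ico_subset_Icc_self hy)

theorem periodicCk_weight (hF : ExpandingLift d F) : PeriodicCk 2 (weight F) :=
  ⟨hF.contDiff_weight, hF.weight_periodic⟩

theorem exists_strictCone_one (hF : ExpandingLift d F) : ∃ a κ, StrictCone 1 d a κ F := by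
  obtain ⟨θ, hθ1, hθ⟩ := hF.exists_weight_le
  obtain ⟨K, hK⟩ := hF.periodicCk_weight.exists_ckBound
  exact ⟨_, _, hF.strictCone_one hθ hθ1 fun t => by simpa using hK 1 (by norm_num) t⟩

theorem exists_strictCone_two (hF : ExpandingLift d F) : ∃ a κ, StrictCone 2 d a κ F := by
  obtain ⟨θ, hθ1, hθ⟩ := hF.exists_weight_le
  obtain ⟨K, hK⟩ := hF.periodicCk_weight.exists_ckBound
  have hθ0 : 0 ≤ θ := (hF.weight_pos 0).le.trans (hθ 0)
  have hK0 : 0 ≤ K := hK.nonneg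
  have hK1 : ∀ t, |deriv (weight F) t| ≤ K := fun t => by
    simpa using hK 1 (by norm_num) t
  have hK2 : ∀ t, |deriv (deriv (weight F)) t| ≤ K := fun t => by
    simpa [iteratedDeriv_succ] using hK 2 le_rfl t
  -- The second derivative produces the error `3 * a * K + K + K ^ 2`, at most `B * a` as `a ≥ 1`.
  -- The choice of `a` makes half the gap, `(1 - θ) / 2 * a ^ 2`, equal to `(B + 1) * a`.
  set B := 4 * K + K ^ 2 with hB
  have hB0 : 0 ≤ B := by positivity
  set a := coneConst θ B with ha
  have ha1 : 1 ≤ a := one_le_coneConst hθ0 hθ1 hB0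
  have hmul : (1 - θ) * a = 2 * (B + 1) := coneConst_mul hθ1
  refine ⟨a, (1 + θ) / 2, hF, by norm_num, le_rfl, ha1, by linarith, by linarith,
    fun f hf j hj0 hj2 t => ?_⟩
  have hL := hF.liftTransfer_nonneg hf.nonneg t
  interval_cases j
  · rw [iteratedDeriv_one, pow_one]
    refine (hF.abs_deriv_liftTransfer_le (by norm_num) hθ hK1 (by linarith) hf t).trans
      (mul_le_mul_of_nonneg_right ?_ hL)
    nlinarith
  · have e : iteratedDeriv 2 (liftTransfer d F f) t = deriv (deriv (liftTransfer d F f)) t := by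
      simp [iteratedDeriv_succ]
    rw [e, hF.deriv_deriv_liftTransfer hf.contDiff]
    refine (abs_branchSum_le_mul (c := θ ^ 2 * a ^ 2 + 3 * a * K + (K + K ^ 2))
      (v := fun t => f t * weight F t) (fun t => ?_) t).trans
      (mul_le_mul_of_nonneg_right ?_ hL)
    · have hw := hF.weight_pos t
      have hw1 := (hF.weight_lt_one t).le
      have hfn := hf.nonneg t
      have h1 : |deriv f t| ≤ a * f t := by simpa using hf.bound 1 (by norm_num) t
      have h2 : |deriv (deriv f) t| ≤ a ^ 2 * f t := by
        simpa [iteratedDeriv_succ] using hf.bound 2 le_rfl t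
      rw [abs_mul, abs_of_pos hw, ← mul_assoc]
      refine mul_le_mul_of_nonneg_right ?_ hw.le
      have e1 : |deriv (deriv f) t * weight F t ^ 2| ≤ a ^ 2 * f t * θ ^ 2 := by
        rw [abs_mul, abs_of_pos (pow_pos hw 2)]
        exact mul_le_mul h2 (pow_le_pow_left₀ hw.le (hθ t) 2) (by positivity) (by positivity)
      have e2 : |3 * deriv f t * weight F t * deriv (weight F) t| ≤ 3 * (a * f t) * 1 * K := by
        rw [abs_mul, abs_mul, abs_mul, abs_of_pos hw, abs_of_pos (three_pos : (0 : ℝ) < 3)]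
        gcongr
        exact hK1 t
      have e3 : |f t * (weight F t * deriv (deriv (weight F)) t + deriv (weight F) t ^ 2)|
          ≤ f t * (1 * K + K ^ 2) := by
        rw [abs_mul, abs_of_nonneg hfn]
        refine mul_le_mul_of_nonneg_left ((abs_add_le _ _).trans ?_) hfn
        rw [abs_mul, abs_of_pos hw, abs_pow]
        gcongr
        · exact hK2 t
        · exact hK1 t
      refine ((abs_add_le _ _).trans (add_le_add ((abs_add_le _ _).trans
        (add_le_add e1 e2)) e3)).trans (le_of_eq (by ring))
    · have h3 : θ ^ 2 * a ^ 2 ≤ θ * a ^ 2 :=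
        mul_le_mul_of_nonneg_right (by nlinarith) (by positivity)
      have h4 : (1 - θ) * a ^ 2 = 2 * (B + 1) * a := by rw [← hmul]; ring
      have h5 : K + K ^ 2 ≤ (K + K ^ 2) * a := le_mul_of_one_le_right (by positivity) ha1
      nlinarith

/-- Existence of a positive `C^2` invariant density for the lifted transfer operator. -/
theorem exists_invariant (hF : ExpandingLift d F) :
    ∃ f, PeriodicCk 2 f ∧ (∀ t, 0 < f t) ∧ ∫ t in (0 : ℝ)..1, f t = 1 ∧
      ∀ t, liftTransfer d F f t = f t := by
  obtain ⟨a, κ, h⟩ := hF.exists_strictCone_two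
  have h1 : PeriodicCk 2 fun _ : ℝ => (1 : ℝ) := PeriodicCk.const 1
  -- The density is `1 + v` with `v - L v = L 1 - 1`; it is the limit of the iterates `L^n 1`.
  set g : ℝ → ℝ := fun t => liftTransfer d F (fun _ => 1) t - 1 with hg
  have hgp : PeriodicCk 2 g := (h.periodicCk_liftTransfer h1).sub h1
  have hg0 : ∫ t in (0 : ℝ)..1, g t = 0 := by
    rw [intervalIntegral.integral_sub
      ((h.periodicCk_liftTransfer h1).continuous.intervalIntegrable _ _)
      (continuous_const.intervalIntegrable _ _), h.integral_liftTransfer h1.continuous h1.periodic,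
      sub_self]
  obtain ⟨v, hv, hv0, hvg, b, hb, hbn⟩ := h.exists_resolvent hgp hg0
  have hpart : ∀ n t, 1 + ∑ i ∈ Finset.range n, (liftTransfer d F)^[i] g t
      = (liftTransfer d F)^[n] (fun _ => 1) t := fun n t => by
    induction n with
    | zero => simp
    | succ n ih =>
      rw [Finset.sum_range_succ, ← add_assoc, ih, hg, StrictCone.iterate_sub,
        Function.iterate_succ_apply]
      ring
  have hcone : ∀ n, InCone 2 a ((liftTransfer d F)^[n] fun _ => 1) := fun n => by
    induction n with
    | zero => exact InCone.const zero_le_one h.a_nonneg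
    | succ n ih => rw [Function.iterate_succ_apply']; exact h.inCone_liftTransfer ih
  refine ⟨fun t => 1 + v t, h1.add hv, fun t => ?_, ?_, fun t => ?_⟩
  -- Positivity survives the limit because each `L^n 1` lies in the cone with mass `1`, hence is at
  -- least `exp (-a)`.
  · have hn : ∀ n, Real.exp (-a) - b n ≤ 1 + v t := fun n => by
      have e1 := (hcone n).exp_neg_mul_integral_le h.one_le h.a_nonneg t
      rw [h.integral_iterate h1] at e1
      simp only [intervalIntegral.integral_const, sub_zero, one_smul, mul_one] at e1
      have e2 := (abs_le.1 ((hbn n).abs_le t)).2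
      rw [← hpart] at e1
      linarith
    have hl : Tendsto (fun n => Real.exp (-a) - b n) atTop (𝓝 (Real.exp (-a) - 0)) :=
      hb.const_sub _
    have := le_of_tendsto' hl hn
    linarith [Real.exp_pos (-a)]
  · rw [intervalIntegral.integral_add (continuous_const.intervalIntegrable _ _)
      (hv.continuous.intervalIntegrable _ _), hv0]
    simp
  · rw [liftTransfer_add]
    have := hvg t
    simp only [hg] at this ⊢
    linarith

/-- A nonnegative continuous fixed point of the transfer operator with a zero vanishes. -/
theorem eq_zero_of_fixed (hF : ExpandingLift d F) {f : ℝ → ℝ} (hf : Continuous f)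
    (hp : Function.Periodic f 1) (h0 : ∀ t, 0 ≤ f t) (hL : ∀ t, liftTransfer d F f t = f t)
    {s : ℝ} (hs : f s = 0) (t : ℝ) : f t = 0 := by
  obtain ⟨θ, hθ1, hθ⟩ := hF.exists_weight_le
  have hθ0 : 0 ≤ θ := (hF.weight_pos 0).le.trans (hθ 0)
  lift θ to NNReal using hθ0
  -- A zero of `f = L f` forces every term of the nonnegative branch sum to vanish; the branch `i =
  -- 0` suffices.
  have hback : ∀ x, f x = 0 → f (invLift F x) = 0 := fun x hx => by
    have h1 := hL x
    rw [hx, liftTransfer, branchSum, Finset.sum_eq_zero_iff_of_nonneg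
      fun i _ => mul_nonneg (h0 _) (hF.weight_pos _).le] at h1
    have h2 := h1 0 (Finset.mem_range.2 hF.degree_pos)
    rw [Nat.cast_zero, add_zero] at h2
    exact (mul_eq_zero.1 h2).resolve_right (hF.weight_pos _).ne'
  have hlip : LipschitzWith θ (invLift F) :=
    lipschitzWith_of_nnnorm_deriv_le (fun x => (hF.hasDerivAt_invLift x).differentiableAt)
      fun x => by
        rw [(hF.hasDerivAt_invLift x).deriv, ← NNReal.coe_le_coe, coe_nnnorm, Real.norm_eq_abs,
          abs_of_pos (hF.weight_pos _)]
        exact hθ _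
  -- By periodicity there is a zero within `1` of `F^[n] t`. Pulling it back `n` times gives a zero
  -- within `θ ^ n` of `t`.
  have hall : ∀ n : ℕ, ∃ y, f y = 0 ∧ |y - t| ≤ (θ : ℝ) ^ n := fun n => by
    obtain ⟨z, hz, hz1⟩ : ∃ z, f z = 0 ∧ |z - F^[n] t| ≤ 1 := by
      obtain ⟨z, hz, h⟩ : ∃ z ∈ Ico (F^[n] t) (F^[n] t + 1), f s = f z :=
        hp.exists_mem_Ico one_pos s (F^[n] t)
      refine ⟨z, h ▸ hs, ?_⟩
      rw [abs_le]; constructor <;> linarith [hz.1, hz.2]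
    refine ⟨(invLift F)^[n] z, ?_, ?_⟩
    · clear hz1
      induction n generalizing z with
      | zero => exact hz
      | succ n ih => rw [Function.iterate_succ_apply]; exact ih _ (hback z hz)
    · have h1 := (hlip.iterate n).dist_le_mul z (F^[n] t)
      have h2 : Function.LeftInverse (invLift F)^[n] F^[n] :=
        Function.LeftInverse.iterate hF.invLift_apply n
      rw [h2 t, Real.dist_eq, Real.dist_eq] at h1
      refine h1.trans ?_
      simpa using mul_le_mul_of_nonneg_left hz1 (pow_nonneg θ.coe_nonneg n)
  choose y hy hyt using hall
  have hlim : Tendsto y atTop (𝓝 t) := by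
    rw [tendsto_iff_dist_tendsto_zero]
    exact squeeze_zero (fun _ => dist_nonneg) hyt
      (tendsto_pow_atTop_nhds_zero_of_lt_one θ.coe_nonneg hθ1)
  have := (hf.tendsto t).comp hlim
  simp only [Function.comp_def, hy] at this
  exact tendsto_nhds_unique this tendsto_const_nhds

/-- Uniqueness of the continuous invariant density. -/
theorem eq_of_fixed (hF : ExpandingLift d F) {f g : ℝ → ℝ} (hf : Continuous f)
    (hp : Function.Periodic f 1) (hL : ∀ t, liftTransfer d F f t = f t)
    (hfI : ∫ t in (0 : ℝ)..1, f t = 1) (hg : Continuous g)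
    (hgp : Function.Periodic g 1) (hgL : ∀ t, liftTransfer d F g t = g t)
    (hgI : ∫ t in (0 : ℝ)..1, g t = 1) (hg0 : ∀ t, 0 < g t) : f = g := by
  -- With `m` the minimum of `f / g`, the function `f - m * g` is nonnegative, fixed and has a zero,
  -- so it vanishes. Equality of masses gives `m = 1`, and no sign of `f` is needed.
  obtain ⟨s, -, hs⟩ := (isCompact_Icc (a := (0 : ℝ)) (b := 1)).exists_isMinOn
    ⟨0, by simp⟩ (hf.div hg fun t => (hg0 t).ne').continuousOn
  set m := f s / g s with hm
  have hmin : ∀ t, m * g t ≤ f t := fun t => by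
    have hq : Function.Periodic (fun t => f t / g t) 1 := fun t => by simp only [hp t, hgp t]
    obtain ⟨y, hy, h⟩ := hq.exists_mem_Ico₀ one_pos t
    rw [← le_div_iff₀ (hg0 t)]
    exact (hs (Ico_subset_Icc_self hy)).trans_eq h.symm
  have hz : ∀ t, f t - m * g t = 0 := fun t =>
    hF.eq_zero_of_fixed (f := fun t => f t - m * g t) (hf.sub (continuous_const.mul hg))
      (fun t => by simp only [hp t, hgp t]) (fun t => sub_nonneg.2 (hmin t))
      (fun t => by
        rw [liftTransfer_sub, liftTransfer_const_mul]
        simp only [hL, hgL]) (s := s)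
      (by rw [hm, div_mul_cancel₀ _ (hg0 s).ne', sub_self]) t
  have hfm : f = fun t => m * g t := funext fun t => sub_eq_zero.1 (hz t)
  have hm1 : m = 1 := by
    rw [hfm, intervalIntegral.integral_const_mul, hgI, mul_one] at hfI
    exact hfI
  rw [hfm, hm1]; simp

end ExpandingLift

end CircleMap

/-! ### Calculus of uniform first-order expansions in `δ`. -/

namespace CircleMap

/-- The function factors through the compact circle. -/
theorem uniformContinuous_of_periodic {f : ℝ → ℝ} (hf : Continuous f)
    (hp : Function.Periodic f 1) : UniformContinuous f := by
  have hc : Continuous (hp.lift : UnitAddCircle → ℝ) := continuous_coinduced_dom.2 hf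
  have h1 : UniformContinuous (hp.lift : UnitAddCircle → ℝ) :=
    CompactSpace.uniformContinuous_of_continuous hc
  have h2 : UniformContinuous (QuotientAddGroup.mk' (AddSubgroup.zmultiples (1 : ℝ))) :=
    uniformContinuous_of_continuousAt_zero _ continuous_quotient_mk'.continuousAt
  exact h1.comp h2

section Uniform

variable {ι α : Type*} {l : Filter ι} {u v : ι → α → ℝ} {u₀ v₀ : α → ℝ}

theorem tendstoUniformly_iff_abs :
    TendstoUniformly u u₀ l ↔ ∀ c > 0, ∀ᶠ i in l, ∀ x, |u i x - u₀ x| < c := by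
  simp only [Metric.tendstoUniformly_iff, dist_comm (u₀ _), Real.dist_eq]

theorem tendstoUniformly_of_abs_le {b : ι → ℝ}
    (h : ∀ᶠ i in l, ∀ x, |u i x - u₀ x| ≤ b i) (hb : Tendsto b l (𝓝 0)) :
    TendstoUniformly u u₀ l := by
  rw [tendstoUniformly_iff_abs]
  intro c hc
  filter_upwards [h, hb.eventually_lt_const hc] with i h1 h2 x
  exact (h1 x).trans_lt h2

theorem _root_.TendstoUniformly.mul_of_bounded (hu : TendstoUniformly u u₀ l)
    (hv : TendstoUniformly v v₀ l) {M N : ℝ} (hM : ∀ x, |u₀ x| ≤ M) (hN : ∀ x, |v₀ x| ≤ N) :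
    TendstoUniformly (fun i x => u i x * v i x) (fun x => u₀ x * v₀ x) l := by
  rw [tendstoUniformly_iff_abs] at *
  intro c hc
  have hD : 0 < |M| + |N| + 1 := by positivity
  -- The bound `η ≤ 1` makes the quadratic term linear; the three errors then add up to at most `η *
  -- (|M| + |N| + 1)`.
  set η := min 1 (c / (|M| + |N| + 1)) with hη
  have hη0 : 0 < η := lt_min one_pos (div_pos hc hD)
  have hη1 : η ≤ 1 := min_le_left _ _
  have hη2 : η * (|M| + |N| + 1) ≤ c := (le_div_iff₀ hD).1 (min_le_right _ _)
  filter_upwards [hu η hη0, hv η hη0] with i h1 h2 x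
  have e : u i x * v i x - u₀ x * v₀ x = (u i x - u₀ x) * (v i x - v₀ x)
      + (u i x - u₀ x) * v₀ x + u₀ x * (v i x - v₀ x) := by ring
  rw [e]
  have hM' := (hM x).trans (le_abs_self M)
  have hN' := (hN x).trans (le_abs_self N)
  have b1 : |(u i x - u₀ x) * (v i x - v₀ x)| < η * 1 := by
    rw [abs_mul]
    exact mul_lt_mul'' (h1 x) ((h2 x).trans_le hη1) (abs_nonneg _) (abs_nonneg _)
  have b2 : |(u i x - u₀ x) * v₀ x| ≤ η * |N| := by
    rw [abs_mul]; exact mul_le_mul (h1 x).le hN' (abs_nonneg _) hη0.le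
  have b3 : |u₀ x * (v i x - v₀ x)| ≤ |M| * η := by
    rw [abs_mul]; exact mul_le_mul hM' (h2 x).le (abs_nonneg _) (abs_nonneg _)
  have b4 := abs_add_three ((u i x - u₀ x) * (v i x - v₀ x)) ((u i x - u₀ x) * v₀ x)
    (u₀ x * (v i x - v₀ x))
  linarith

theorem tendstoUniformly_const (w : α → ℝ) : TendstoUniformly (fun _ : ι => w) w l :=
  tendstoUniformly_of_abs_le (b := fun _ => 0) (Eventually.of_forall fun _ x => by simp)
    tendsto_const_nhds

theorem tendstoUniformly_finsetSum {β : Type*} {w : β → ι → α → ℝ} {w₀ : β → α → ℝ}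
    (s : Finset β) (h : ∀ b, TendstoUniformly (w b) (w₀ b) l) :
    TendstoUniformly (fun i x => ∑ b ∈ s, w b i x) (fun x => ∑ b ∈ s, w₀ b x) l := by
  classical
  induction s using Finset.induction_on with
  | empty => simpa using tendstoUniformly_const (l := l) fun _ : α => (0 : ℝ)
  | insert b s hb ih =>
    simp only [Finset.sum_insert hb]
    exact (h b).add ih

theorem _root_.TendstoUniformly.congr_of_eventually (hu : TendstoUniformly u u₀ l)
    (h : ∀ᶠ i in l, ∀ x, u i x = v i x) : TendstoUniformly v u₀ l := by
  rw [tendstoUniformly_iff_abs] at *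
  intro c hc
  filter_upwards [hu c hc, h] with i h1 h2 x
  rw [← h2]; exact h1 x

theorem _root_.TendstoUniformly.comp_of_uniformContinuous {φ : ι → ℝ → ℝ} {φ₀ : ℝ → ℝ}
    (hφ : TendstoUniformly φ φ₀ l) (hc : UniformContinuous φ₀) (hu : TendstoUniformly u u₀ l) :
    TendstoUniformly (fun i x => φ i (u i x)) (fun x => φ₀ (u₀ x)) l := by
  have h1 := hc.comp_tendstoUniformly hu
  rw [tendstoUniformly_iff_abs] at *
  intro c hc
  filter_upwards [h1 (c / 2) (by linarith), hφ (c / 2) (by linarith)] with i h2 h3 x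
  have e2 : |φ₀ (u i x) - φ₀ (u₀ x)| < c / 2 := h2 x
  have := abs_add_le (φ i (u i x) - φ₀ (u i x)) (φ₀ (u i x) - φ₀ (u₀ x))
  rw [sub_add_sub_cancel] at this
  linarith [h3 (u i x)]

end Uniform

theorem exists_mean_value {Ψ Ψ' : ℝ → ℝ} (h : ∀ x, HasDerivAt Ψ (Ψ' x) x) (x y : ℝ) :
    ∃ ξ, |ξ - x| ≤ |y - x| ∧ Ψ y - Ψ x = Ψ' ξ * (y - x) := by
  have hc : Continuous Ψ := continuous_iff_continuousAt.2 fun x => (h x).continuousAt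
  rcases lt_trichotomy x y with hxy | rfl | hxy
  · obtain ⟨ξ, hξ, e⟩ := exists_hasDerivAt_eq_slope Ψ Ψ' hxy hc.continuousOn fun z _ => h z
    refine ⟨ξ, ?_, ?_⟩
    · rw [abs_of_pos (sub_pos.2 hξ.1), abs_of_pos (sub_pos.2 hxy)]; linarith [hξ.2]
    · rw [e, div_mul_cancel₀ _ (sub_pos.2 hxy).ne']
  · exact ⟨x, by simp⟩
  · obtain ⟨ξ, hξ, e⟩ := exists_hasDerivAt_eq_slope Ψ Ψ' hxy hc.continuousOn fun z _ => h z
    refine ⟨ξ, ?_, ?_⟩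
    · rw [abs_of_neg (sub_neg.2 hξ.2), abs_of_neg (sub_neg.2 hxy)]; linarith [hξ.1]
    · have := (sub_pos.2 hxy).ne'
      rw [e]; field_simp; ring

/-- Uniform first-order expansion of `Ψ (x + δ u_δ(x))` as `δ → 0⁺`. -/
theorem tendstoUniformly_slope_comp {Ψ Ψ' : ℝ → ℝ} (h : ∀ x, HasDerivAt Ψ (Ψ' x) x)
    (hc : UniformContinuous Ψ') {M N : ℝ} (hM : ∀ x, |Ψ' x| ≤ M) {u : ℝ → ℝ → ℝ} {u₀ : ℝ → ℝ}
    (hu : TendstoUniformly u u₀ (𝓝[>] 0)) (hN : ∀ x, |u₀ x| ≤ N) :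
    TendstoUniformly (fun δ x => (Ψ (x + δ * u δ x) - Ψ x) / δ) (fun x => Ψ' x * u₀ x)
      (𝓝[>] 0) := by
  -- The slope is exactly `Ψ' ξ * u`, with `ξ` within `O(δ)` of `x` uniformly; uniform continuity of
  -- `Ψ'` finishes.
  choose ξ hξ e using fun δ x => exists_mean_value h x (x + δ * u δ x)
  have hξ' : TendstoUniformly ξ id (𝓝[>] 0) := by
    refine tendstoUniformly_of_abs_le (b := fun δ => δ * (N + 1)) ?_ ?_
    · filter_upwards [tendstoUniformly_iff_abs.1 hu 1 one_pos, self_mem_nhdsWithin] with δ h1 h2 x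
      refine (hξ δ x).trans ?_
      have h3 : (0 : ℝ) < δ := h2
      rw [add_sub_cancel_left, abs_mul, abs_of_pos h3]
      refine mul_le_mul_of_nonneg_left ?_ h3.le
      have := abs_add_le (u δ x - u₀ x) (u₀ x)
      rw [sub_add_cancel] at this
      linarith [h1 x, hN x]
    · have : Tendsto (fun δ : ℝ => δ * (N + 1)) (𝓝 0) (𝓝 (0 * (N + 1))) :=
        tendsto_id.mul_const _
      rw [zero_mul] at this
      exact this.mono_left nhdsWithin_le_nhds
  have h1 := (hc.comp_tendstoUniformly hξ').mul_of_bounded hu hM hN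
  refine h1.congr_of_eventually ?_
  filter_upwards [self_mem_nhdsWithin] with δ hδ x
  have h3 : δ ≠ 0 := (show (0 : ℝ) < δ from hδ).ne'
  simp only [Function.comp, e, add_sub_cancel_left]
  field_simp

/-- `u_δ = u₀ + δ v + o(δ)` uniformly, with `u₀` and `v` bounded. -/
structure UnifSlope (u : ℝ → ℝ → ℝ) (u₀ v : ℝ → ℝ) : Prop where
  bounded : ∃ M, ∀ t, |u₀ t| ≤ M
  bounded_slope : ∃ M, ∀ t, |v t| ≤ M
  slope : TendstoUniformly (fun δ t => (u δ t - u₀ t) / δ) v (𝓝[>] 0)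

/-- A uniform expansion implies uniform convergence. -/
theorem tendstoUniformly_of_slope {u : ℝ → ℝ → ℝ} {u₀ v : ℝ → ℝ} {M : ℝ} (hM : ∀ t, |v t| ≤ M)
    (h : TendstoUniformly (fun δ t => (u δ t - u₀ t) / δ) v (𝓝[>] 0)) :
    TendstoUniformly u u₀ (𝓝[>] 0) := by
  refine tendstoUniformly_of_abs_le (b := fun δ => δ * (M + 1)) ?_ ?_
  · filter_upwards [tendstoUniformly_iff_abs.1 h 1 one_pos, self_mem_nhdsWithin] with δ h1 h2 x
    have h3 : (0 : ℝ) < δ := h2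
    have e : u δ x - u₀ x = δ * ((u δ x - u₀ x) / δ) := by field_simp
    rw [e, abs_mul, abs_of_pos h3]
    refine mul_le_mul_of_nonneg_left ?_ h3.le
    have := abs_add_le ((u δ x - u₀ x) / δ - v x) (v x)
    rw [sub_add_cancel] at this
    linarith [h1 x, hM x]
  · have : Tendsto (fun δ : ℝ => δ * (M + 1)) (𝓝 0) (𝓝 (0 * (M + 1))) :=
      tendsto_id.mul_const _
    rw [zero_mul] at this
    exact this.mono_left nhdsWithin_le_nhds

namespace UnifSlope

variable {u w : ℝ → ℝ → ℝ} {u₀ v w₀ z : ℝ → ℝ}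

theorem tendsto (h : UnifSlope u u₀ v) : TendstoUniformly u u₀ (𝓝[>] 0) :=
  tendstoUniformly_of_slope h.bounded_slope.choose_spec h.slope

theorem const (hM : ∃ M, ∀ t, |u₀ t| ≤ M) : UnifSlope (fun _ => u₀) u₀ fun _ => 0 :=
  ⟨hM, ⟨0, fun _ => by simp⟩, by simpa using tendstoUniformly_const fun _ : ℝ => (0 : ℝ)⟩

theorem add (hu : UnifSlope u u₀ v) (hw : UnifSlope w w₀ z) :
    UnifSlope (fun δ t => u δ t + w δ t) (fun t => u₀ t + w₀ t) fun t => v t + z t := by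
  obtain ⟨⟨M, hM⟩, ⟨N, hN⟩, h⟩ := hu
  obtain ⟨⟨M', hM'⟩, ⟨N', hN'⟩, h'⟩ := hw
  refine ⟨⟨M + M', fun t => (abs_add_le _ _).trans (add_le_add (hM t) (hM' t))⟩,
    ⟨N + N', fun t => (abs_add_le _ _).trans (add_le_add (hN t) (hN' t))⟩,
    (h.add h').congr_of_eventually (Eventually.of_forall fun δ t => ?_)⟩
  simp only [Pi.add_apply]; ring

theorem exists_bound_mul {f g : ℝ → ℝ} (hf : ∃ M, ∀ t, |f t| ≤ M) (hg : ∃ M, ∀ t, |g t| ≤ M) :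
    ∃ M, ∀ t, |f t * g t| ≤ M := by
  obtain ⟨M, hM⟩ := hf
  obtain ⟨N, hN⟩ := hg
  refine ⟨M * N, fun t => ?_⟩
  rw [abs_mul]
  exact mul_le_mul (hM t) (hN t) (abs_nonneg _) ((abs_nonneg _).trans (hM t))

/-- The split `(u - u₀) * w + u₀ * (w - w₀)` reduces this to products of uniformly convergent
families with bounded limits. -/
theorem mul (hu : UnifSlope u u₀ v) (hw : UnifSlope w w₀ z) :
    UnifSlope (fun δ t => u δ t * w δ t) (fun t => u₀ t * w₀ t)
      fun t => v t * w₀ t + u₀ t * z t := by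
  have h1 := hu.slope.mul_of_bounded hw.tendsto hu.bounded_slope.choose_spec
    hw.bounded.choose_spec
  have h2 := (tendstoUniformly_const u₀).mul_of_bounded hw.slope hu.bounded.choose_spec
    hw.bounded_slope.choose_spec
  refine ⟨exists_bound_mul hu.bounded hw.bounded, ?_,
    (h1.add h2).congr_of_eventually (Eventually.of_forall fun δ t => ?_)⟩
  · obtain ⟨M, hM⟩ := exists_bound_mul hu.bounded_slope hw.bounded
    obtain ⟨N, hN⟩ := exists_bound_mul hu.bounded hw.bounded_slope
    exact ⟨M + N, fun t => (abs_add_le _ _).trans (add_le_add (hM t) (hN t))⟩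
  · simp only [Pi.add_apply]; ring

theorem congr (hu : UnifSlope u u₀ v) (h : ∀ᶠ δ in 𝓝[>] 0, ∀ t, u δ t = w δ t)
    (h₀ : ∀ t, u₀ t = w₀ t) (hv : ∀ t, v t = z t) : UnifSlope w w₀ z := by
  obtain rfl : u₀ = w₀ := funext h₀
  obtain rfl : v = z := funext hv
  refine ⟨hu.bounded, hu.bounded_slope, hu.slope.congr_of_eventually ?_⟩
  filter_upwards [h] with δ h1 t
  simp only [h1]

theorem inv (hu : UnifSlope u u₀ v) (h1 : ∀ᶠ δ in 𝓝[>] 0, ∀ t, 1 < u δ t)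
    (h0 : ∀ t, 1 < u₀ t) :
    UnifSlope (fun δ t => (u δ t)⁻¹) (fun t => (u₀ t)⁻¹) fun t => -v t * (u₀ t)⁻¹ ^ 2 := by
  have hb : ∀ t, |(u₀ t)⁻¹| ≤ 1 := fun t => by
    rw [abs_of_pos (inv_pos.2 (one_pos.trans (h0 t)))]
    exact (inv_lt_one_of_one_lt₀ (h0 t)).le
  have hb2 : ∀ t, |(u₀ t)⁻¹ ^ 2| ≤ 1 := fun t => by
    rw [abs_pow]; exact pow_le_one₀ (abs_nonneg _) (hb t)
  have hdiff : ∀ a b : ℝ, 1 < a → 1 < b → a⁻¹ - b⁻¹ = -(a - b) * a⁻¹ * b⁻¹ := fun a b ha hb => by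
    have : a ≠ 0 := by linarith
    have : b ≠ 0 := by linarith
    field_simp; ring
  have ht : TendstoUniformly (fun δ t => (u δ t)⁻¹) (fun t => (u₀ t)⁻¹) (𝓝[>] 0) := by
    have := hu.tendsto
    rw [tendstoUniformly_iff_abs] at *
    intro c hc
    filter_upwards [this c hc, h1] with δ h2 h3 t
    rw [hdiff _ _ (h3 t) (h0 t), abs_mul, abs_mul, abs_neg]
    have e1 : |(u δ t)⁻¹| ≤ 1 := by
      rw [abs_of_pos (inv_pos.2 (one_pos.trans (h3 t)))]
      exact (inv_lt_one_of_one_lt₀ (h3 t)).le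
    calc |u δ t - u₀ t| * |(u δ t)⁻¹| * |(u₀ t)⁻¹| ≤ |u δ t - u₀ t| * 1 * 1 := by
          gcongr; exact hb t
      _ < c := by simpa using h2 t
  obtain ⟨N, hN⟩ := hu.bounded_slope
  have h4 := ((hu.slope.mul_of_bounded ht hN hb).mul_of_bounded
    (tendstoUniformly_const fun t => -(u₀ t)⁻¹)
    (exists_bound_mul ⟨N, hN⟩ ⟨1, hb⟩).choose_spec (N := 1) fun t => by rw [abs_neg]; exact hb t)
  refine ⟨⟨1, hb⟩, exists_bound_mul ⟨N, fun t => by rw [abs_neg]; exact hN t⟩ ⟨1, hb2⟩, ?_⟩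
  have e : (fun t => -v t * (u₀ t)⁻¹ ^ 2) = fun t => v t * (u₀ t)⁻¹ * -(u₀ t)⁻¹ := by
    funext t; ring
  rw [e]
  refine h4.congr_of_eventually ?_
  filter_upwards [h1] with δ h3 t
  simp only [hdiff _ _ (h3 t) (h0 t)]
  ring

end UnifSlope

/-! ### First-order expansion of the transfer operators of a family of lifts. -/

/-- A family of expanding lifts with `F_δ = F₀ + δ e + o(δ)` in `C^2`. -/
structure LiftFamily (d : ℕ) (F : ℝ → ℝ → ℝ) (F₀ e : ℝ → ℝ) : Prop where
  base : ExpandingLift d F₀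
  lift : ∀ᶠ δ in 𝓝[>] 0, ExpandingLift d (F δ)
  smooth : PeriodicCk 3 e
  slope_zero : TendstoUniformly (fun δ t => (F δ t - F₀ t) / δ) e (𝓝[>] 0)
  slope_one : TendstoUniformly (fun δ t => (deriv (F δ) t - deriv F₀ t) / δ) (deriv e) (𝓝[>] 0)
  slope_two : TendstoUniformly
    (fun δ t => (deriv (deriv (F δ)) t - deriv (deriv F₀) t) / δ) (deriv (deriv e)) (𝓝[>] 0)

theorem PeriodicCk.deriv {k : ℕ} {f : ℝ → ℝ} (hf : PeriodicCk (k + 1) f) :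
    PeriodicCk k (deriv f) :=
  ⟨(contDiff_succ_iff_deriv.1 (by exact_mod_cast hf.contDiff)).2.2, by
    simpa using hf.periodic_iteratedDeriv 1⟩

theorem PeriodicCk.exists_abs_le {k : ℕ} {f : ℝ → ℝ} (hf : PeriodicCk k f) :
    ∃ M, ∀ t, |f t| ≤ M :=
  exists_abs_le_of_periodic hf.continuous hf.periodic

theorem PeriodicCk.mul {k : ℕ} {f g : ℝ → ℝ} (hf : PeriodicCk k f) (hg : PeriodicCk k g) :
    PeriodicCk k fun t => f t * g t :=
  ⟨hf.contDiff.mul hg.contDiff, fun t => by simp only [hf.periodic t, hg.periodic t]⟩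

theorem PeriodicCk.uniformContinuous {k : ℕ} {f : ℝ → ℝ} (hf : PeriodicCk k f) :
    UniformContinuous f :=
  uniformContinuous_of_periodic hf.continuous hf.periodic

theorem PeriodicCk.hasDerivAt {k : ℕ} {f : ℝ → ℝ} (hf : PeriodicCk (k + 1) f) (t : ℝ) :
    HasDerivAt f (_root_.deriv f t) t :=
  (hf.contDiff.differentiable (by exact_mod_cast k.succ_ne_zero) t).hasDerivAt

theorem ExpandingLift.periodicCk_deriv {d : ℕ} {F : ℝ → ℝ} (hF : ExpandingLift d F) :
    PeriodicCk 2 (deriv F) := ⟨hF.contDiff_deriv, hF.deriv_periodic⟩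

theorem ExpandingLift.lipschitzWith_invLift {d : ℕ} {F : ℝ → ℝ} (hF : ExpandingLift d F) :
    LipschitzWith 1 (invLift F) :=
  lipschitzWith_of_nnnorm_deriv_le (fun x => (hF.hasDerivAt_invLift x).differentiableAt)
    fun x => by
      rw [(hF.hasDerivAt_invLift x).deriv, ← NNReal.coe_le_coe, coe_nnnorm, Real.norm_eq_abs,
        abs_of_pos (hF.weight_pos _)]
      exact (hF.weight_lt_one _).le

namespace LiftFamily

variable {d : ℕ} {F : ℝ → ℝ → ℝ} {F₀ e : ℝ → ℝ}

theorem unifSlope_weight (h : LiftFamily d F F₀ e) :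
    UnifSlope (fun δ => weight (F δ)) (weight F₀) fun t => -deriv e t * weight F₀ t ^ 2 :=
  UnifSlope.inv ⟨h.base.periodicCk_deriv.exists_abs_le,
    (PeriodicCk.deriv (k := 2) h.smooth).exists_abs_le, h.slope_one⟩
    (h.lift.mono fun _ hδ => hδ.one_lt_deriv) h.base.one_lt_deriv

theorem unifSlope_deriv_weight (h : LiftFamily d F F₀ e) :
    UnifSlope (fun δ => deriv (weight (F δ))) (deriv (weight F₀))
      fun t => -deriv (deriv e) t * weight F₀ t ^ 2
        - 2 * deriv e t * weight F₀ t * deriv (weight F₀) t := by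
  have h2 : UnifSlope (fun δ => deriv (deriv (F δ))) (deriv (deriv F₀)) (deriv (deriv e)) :=
    ⟨(PeriodicCk.deriv (k := 1) h.base.periodicCk_deriv).exists_abs_le,
      (PeriodicCk.deriv (k := 1) (PeriodicCk.deriv (k := 2) h.smooth)).exists_abs_le, h.slope_two⟩
  have h1 := (UnifSlope.const (u₀ := fun _ => -1) ⟨1, fun _ => by simp⟩).mul
    (h2.mul (h.unifSlope_weight.mul h.unifSlope_weight))
  refine h1.congr ?_ (fun t => ?_) fun t => ?_
  · filter_upwards [h.lift] with δ hδ t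
    rw [hδ.deriv_weight]; ring
  · rw [h.base.deriv_weight]; ring
  · rw [h.base.deriv_weight]; ring

/-- The inverse branches at `δ` are those at `0` composed with a displacement of order `δ`. -/
theorem invLift_eq (h : LiftFamily d F F₀ e) {δ : ℝ} (hδ : 0 < δ) (hF : ExpandingLift d (F δ))
    (x : ℝ) : invLift (F δ) x = invLift F₀
      (x + δ * -((F δ (invLift (F δ) x) - F₀ (invLift (F δ) x)) / δ)) := by
  have e1 : x + δ * -((F δ (invLift (F δ) x) - F₀ (invLift (F δ) x)) / δ)
      = F₀ (invLift (F δ) x) := by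
    rw [hF.apply_invLift]; field_simp; ring
  rw [e1, h.base.invLift_apply]

/-- The inverse of `F₀` does not increase distances, so the inverses differ by at most `|F₀ - F δ|`
at the point `invLift (F δ) x`. -/
theorem tendstoUniformly_invLift (h : LiftFamily d F F₀ e) :
    TendstoUniformly (fun δ => invLift (F δ)) (invLift F₀) (𝓝[>] 0) := by
  obtain ⟨M, hM⟩ := h.smooth.exists_abs_le
  have h1 := tendstoUniformly_of_slope hM h.slope_zero
  rw [tendstoUniformly_iff_abs] at *
  intro c hc
  filter_upwards [h1 c hc, h.lift, self_mem_nhdsWithin] with δ h2 h3 h4 x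
  have h5 := h.base.lipschitzWith_invLift.dist_le_mul (F₀ (invLift (F δ) x)) x
  rw [h.base.invLift_apply, Real.dist_eq, Real.dist_eq] at h5
  have h6 := h2 (invLift (F δ) x)
  rw [h3.apply_invLift, abs_sub_comm] at h6
  simp only [NNReal.coe_one, one_mul] at h5
  exact h5.trans_lt h6

/-- The uniform expansion of a sum over inverse branches. -/
theorem tendstoUniformly_slope_branchSum (h : LiftFamily d F F₀ e) {φ : ℝ → ℝ → ℝ}
    {φ₀ ψ : ℝ → ℝ} (hφ : UnifSlope φ φ₀ ψ) (hφ₀ : PeriodicCk 1 φ₀) (hψ : UniformContinuous ψ) :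
    TendstoUniformly (fun δ x => (branchSum d (F δ) (φ δ) x - branchSum d F₀ φ₀ x) / δ)
      (branchSum d F₀ fun t => ψ t - deriv φ₀ t * weight F₀ t * e t) (𝓝[>] 0) := by
  have hG := h.tendstoUniformly_invLift
  have hGu := h.base.lipschitzWith_invLift.uniformContinuous
  have hφw : PeriodicCk 0 fun t => deriv φ₀ t * weight F₀ t :=
    (PeriodicCk.deriv hφ₀).mul (h.base.periodicCk_weight.of_le (by norm_num))
  -- Two effects add: `φ₀ ∘ invLift F₀` is evaluated at a point displaced by about `-δ e`, and `φ`
  -- itself changes by about `δ ψ`.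
  have hΨ : ∀ x, HasDerivAt (fun x => φ₀ (invLift F₀ x))
      (deriv φ₀ (invLift F₀ x) * weight F₀ (invLift F₀ x)) x := fun x =>
    (hφ₀.hasDerivAt (k := 0) _).comp x (h.base.hasDerivAt_invLift x)
  obtain ⟨M, hM⟩ := hφw.exists_abs_le
  obtain ⟨N, hN⟩ := h.smooth.exists_abs_le
  have hu := (h.slope_zero.comp_of_uniformContinuous h.smooth.uniformContinuous hG).neg
  have h1 := tendstoUniformly_slope_comp hΨ (hφw.uniformContinuous.comp hGu)
    (fun x => hM (invLift F₀ x)) hu (N := N) fun x => by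
      simp only [Pi.neg_apply, abs_neg]; exact hN _
  have h2 := hφ.slope.comp_of_uniformContinuous hψ hG
  have h3 : TendstoUniformly (fun δ x => (φ δ (invLift (F δ) x) - φ₀ (invLift F₀ x)) / δ)
      (fun x => ψ (invLift F₀ x) - deriv φ₀ (invLift F₀ x) * weight F₀ (invLift F₀ x)
        * e (invLift F₀ x)) (𝓝[>] 0) := by
    have e1 : (fun x => ψ (invLift F₀ x) - deriv φ₀ (invLift F₀ x) * weight F₀ (invLift F₀ x)
        * e (invLift F₀ x)) = fun x => ψ (invLift F₀ x) + deriv φ₀ (invLift F₀ x)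
        * weight F₀ (invLift F₀ x) * -e (invLift F₀ x) := by funext x; ring
    rw [e1]
    refine (h2.add h1).congr_of_eventually ?_
    filter_upwards [h.lift, self_mem_nhdsWithin] with δ h4 h5 x
    have e2 := h.invLift_eq h5 h4 x
    simp only [Pi.add_apply, Pi.neg_apply]
    rw [← e2]; ring
  have h4 := tendstoUniformly_finsetSum (Finset.range d) fun i : ℕ => h3.comp fun x : ℝ => x + i
  refine h4.congr_of_eventually (Eventually.of_forall fun δ x => ?_)
  simp only [Function.comp, branchSum, ← Finset.sum_sub_distrib, Finset.sum_div]

theorem tendstoUniformly_branchSum (h : LiftFamily d F F₀ e) {φ : ℝ → ℝ → ℝ}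
    {φ₀ : ℝ → ℝ} (hφ : TendstoUniformly φ φ₀ (𝓝[>] 0)) (hφ₀ : UniformContinuous φ₀) :
    TendstoUniformly (fun δ => branchSum d (F δ) (φ δ)) (branchSum d F₀ φ₀) (𝓝[>] 0) :=
  tendstoUniformly_finsetSum (Finset.range d) fun i : ℕ =>
    (hφ.comp_of_uniformContinuous hφ₀ h.tendstoUniformly_invLift).comp fun x : ℝ => x + i

theorem unifSlope_liftTransfer_integrand (h : LiftFamily d F F₀ e) {f : ℝ → ℝ}
    (hf : ∃ M, ∀ t, |f t| ≤ M) :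
    UnifSlope (fun δ t => f t * weight (F δ) t) (fun t => f t * weight F₀ t)
      fun t => f t * (-deriv e t * weight F₀ t ^ 2) :=
  ((UnifSlope.const hf).mul h.unifSlope_weight).congr (Eventually.of_forall fun _ _ => rfl)
    (fun _ => rfl) fun t => by ring

theorem unifSlope_deriv_integrand (h : LiftFamily d F F₀ e) {f f' : ℝ → ℝ}
    (hf : ∃ M, ∀ t, |f t| ≤ M) (hf' : ∃ M, ∀ t, |f' t| ≤ M) :
    UnifSlope
      (fun δ t => (f' t * weight (F δ) t + f t * deriv (weight (F δ)) t) * weight (F δ) t)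
      (fun t => (f' t * weight F₀ t + f t * deriv (weight F₀) t) * weight F₀ t)
      fun t => (f' t * (-deriv e t * weight F₀ t ^ 2)
        + f t * (-deriv (deriv e) t * weight F₀ t ^ 2
          - 2 * deriv e t * weight F₀ t * deriv (weight F₀) t)) * weight F₀ t
        + (f' t * weight F₀ t + f t * deriv (weight F₀) t)
          * (-deriv e t * weight F₀ t ^ 2) :=
  ((((UnifSlope.const hf').mul h.unifSlope_weight).add
    ((UnifSlope.const hf).mul h.unifSlope_deriv_weight)).mul h.unifSlope_weight).congr
    (Eventually.of_forall fun _ _ => rfl) (fun _ => rfl) fun t => by ring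

/-- The derivative at `δ = 0` of `δ ↦ L_δ f`. -/
noncomputable def liftDerivOp (d : ℕ) (F₀ e f : ℝ → ℝ) : ℝ → ℝ :=
  branchSum d F₀ fun t => -(deriv (fun s => f s * weight F₀ s * e s) t * weight F₀ t)

theorem hasDerivAt_mul_weight_mul (h : LiftFamily d F F₀ e) {f : ℝ → ℝ} (hf : PeriodicCk 2 f)
    (t : ℝ) : HasDerivAt (fun s => f s * weight F₀ s * e s)
      ((deriv f t * weight F₀ t + f t * deriv (weight F₀) t) * e t
        + f t * weight F₀ t * deriv e t) t :=
  ((hf.hasDerivAt (k := 1) t).mul (h.base.hasDerivAt_weight t)).mul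
    (h.smooth.hasDerivAt (k := 2) t)

theorem periodicCk_mul_weight_mul (h : LiftFamily d F F₀ e) {f : ℝ → ℝ} (hf : PeriodicCk 2 f) :
    PeriodicCk 2 fun s => f s * weight F₀ s * e s :=
  (hf.mul h.base.periodicCk_weight).mul (h.smooth.of_le (by norm_num))

theorem periodicCk_liftDerivOp_integrand (h : LiftFamily d F F₀ e) {f : ℝ → ℝ}
    (hf : PeriodicCk 2 f) :
    PeriodicCk 1 fun t => -(deriv (fun s => f s * weight F₀ s * e s) t * weight F₀ t) := by
  have h1 := ((PeriodicCk.deriv (k := 1) (h.periodicCk_mul_weight_mul hf)).mul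
    (h.base.periodicCk_weight.of_le one_le_two)).const_mul (-1)
  simpa only [neg_one_mul] using h1

theorem periodicCk_liftDerivOp (h : LiftFamily d F F₀ e) {f : ℝ → ℝ} (hf : PeriodicCk 2 f) :
    PeriodicCk 1 (liftDerivOp d F₀ e f) :=
  ⟨h.base.contDiff_branchSum_one (h.periodicCk_liftDerivOp_integrand hf).contDiff,
    h.base.branchSum_periodic (h.periodicCk_liftDerivOp_integrand hf).periodic⟩

theorem tendstoUniformly_slope_liftTransfer (h : LiftFamily d F F₀ e) {f : ℝ → ℝ}
    (hf : PeriodicCk 2 f) :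
    TendstoUniformly (fun δ x => (liftTransfer d (F δ) f x - liftTransfer d F₀ f x) / δ)
      (liftDerivOp d F₀ e f) (𝓝[>] 0) := by
  have hw := h.base.periodicCk_weight
  have hψ : PeriodicCk 0 fun t => f t * (-deriv e t * weight F₀ t ^ 2) := by
    have := (hf.of_le (l := 0) (by norm_num)).mul
      ((((PeriodicCk.deriv (k := 2) h.smooth).of_le (l := 0) (by norm_num)).const_mul (-1)).mul
      ((hw.mul hw).of_le (by norm_num)))
    simpa only [neg_one_mul, ← sq] using this
  have h1 := h.tendstoUniformly_slope_branchSum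
    (h.unifSlope_liftTransfer_integrand hf.exists_abs_le)
    ((hf.mul hw).of_le (by norm_num)) hψ.uniformContinuous
  -- The change of the weight and the displacement of the branches combine into one total
  -- derivative, `-(f * weight * e)' * weight`.
  have e1 : liftDerivOp d F₀ e f = branchSum d F₀ fun t => f t * (-deriv e t * weight F₀ t ^ 2)
      - deriv (fun t => f t * weight F₀ t) t * weight F₀ t * e t := by
    refine congrArg (branchSum d F₀) (funext fun t => ?_)
    rw [(h.hasDerivAt_mul_weight_mul hf t).deriv,
      ((hf.hasDerivAt (k := 1) t).fun_mul (h.base.hasDerivAt_weight t)).deriv]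
    ring
  rw [e1]
  exact h1

end LiftFamily

end CircleMap

/-! ### Linear response on the line, in `C^1`. -/

namespace CircleMap

theorem ckBound_one_iff {f : ℝ → ℝ} {c : ℝ} :
    CkBound 1 c f ↔ (∀ t, |f t| ≤ c) ∧ ∀ t, |deriv f t| ≤ c := by
  refine ⟨fun h => ⟨h.abs_le, fun t => by simpa using h 1 le_rfl t⟩, fun h j hj t => ?_⟩
  interval_cases j
  · simpa using h.1 t
  · simpa using h.2 t

namespace LiftFamily

variable {d : ℕ} {F : ℝ → ℝ → ℝ} {F₀ e : ℝ → ℝ}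

/-- The expanded form is matched below with the `δ`-slope of `(L_δ f)'`. -/
theorem deriv_liftDerivOp (h : LiftFamily d F F₀ e) {f : ℝ → ℝ} (hf : PeriodicCk 2 f) :
    deriv (liftDerivOp d F₀ e f) = branchSum d F₀ fun t =>
      -(((deriv (deriv f) t * weight F₀ t + 2 * deriv f t * deriv (weight F₀) t
          + f t * deriv (deriv (weight F₀)) t) * e t
        + 2 * (deriv f t * weight F₀ t + f t * deriv (weight F₀) t) * deriv e t
        + f t * weight F₀ t * deriv (deriv e) t) * weight F₀ t
        + ((deriv f t * weight F₀ t + f t * deriv (weight F₀) t) * e t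
          + f t * weight F₀ t * deriv e t) * deriv (weight F₀) t) * weight F₀ t := by
  have hw := h.base.periodicCk_weight
  have hf0 := hf.hasDerivAt (k := 1)
  have hf1 := (PeriodicCk.deriv (k := 1) hf).hasDerivAt (k := 0)
  have hw0 := hw.hasDerivAt (k := 1)
  have hw1 := (PeriodicCk.deriv (k := 1) hw).hasDerivAt (k := 0)
  have he0 := h.smooth.hasDerivAt (k := 2)
  have he1 := (PeriodicCk.deriv (k := 2) h.smooth).hasDerivAt (k := 1)
  rw [liftDerivOp, h.base.deriv_branchSum (h.periodicCk_liftDerivOp_integrand hf).contDiff]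
  refine congrArg (branchSum d F₀) (funext fun t => ?_)
  simp only [fun t => (h.hasDerivAt_mul_weight_mul hf t).deriv]
  have h1 := ((((((hf1 t).fun_mul (hw0 t)).fun_add ((hf0 t).fun_mul (hw1 t))).fun_mul
    (he0 t)).fun_add (((hf0 t).fun_mul (hw0 t)).fun_mul (he1 t))).fun_mul (hw0 t)).fun_neg
  rw [h1.deriv]
  ring

/-- The operator is `L_0` applied to the derivative of a periodic function, and `L_0` preserves
integrals. -/
theorem integral_liftDerivOp (h : LiftFamily d F F₀ e) {f : ℝ → ℝ} (hf : PeriodicCk 2 f) :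
    ∫ t in (0 : ℝ)..1, liftDerivOp d F₀ e f t = 0 := by
  have hp := h.periodicCk_mul_weight_mul hf
  have hp' : PeriodicCk 1 (deriv fun s => f s * weight F₀ s * e s) := PeriodicCk.deriv hp
  have e1 : liftDerivOp d F₀ e f
      = liftTransfer d F₀ fun t => -deriv (fun s => f s * weight F₀ s * e s) t :=
    congrArg (branchSum d F₀) (funext fun t => (neg_mul _ _).symm)
  have hn : PeriodicCk 1 fun t => -deriv (fun s => f s * weight F₀ s * e s) t := by
    simpa only [neg_one_mul] using hp'.const_mul (-1)
  rw [e1, h.base.integral_liftTransfer hn.continuous hn.periodic,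
    intervalIntegral.integral_neg, intervalIntegral.integral_deriv_eq_sub
      (fun t _ => (hp.hasDerivAt (k := 1) t).differentiableAt)
      (hp'.continuous.intervalIntegrable _ _)]
  have := hp.periodic 0
  simp only [zero_add] at this
  rw [this]; simp

/-- Since `(L_δ f)'` is again a branch sum, the general expansion applies. Its integrand contains
`f'`, so `f` must be `C^2`. -/
theorem tendstoUniformly_slope_deriv_liftTransfer (h : LiftFamily d F F₀ e) {f : ℝ → ℝ}
    (hf : PeriodicCk 2 f) :
    TendstoUniformly
      (fun δ x => (deriv (liftTransfer d (F δ) f) x - deriv (liftTransfer d F₀ f) x) / δ)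
      (deriv (liftDerivOp d F₀ e f)) (𝓝[>] 0) := by
  have hw := h.base.periodicCk_weight
  have hf' : PeriodicCk 1 (deriv f) := PeriodicCk.deriv hf
  have hw' : PeriodicCk 1 (deriv (weight F₀)) := PeriodicCk.deriv hw
  have he' : PeriodicCk 2 (deriv e) := PeriodicCk.deriv h.smooth
  have he'' : PeriodicCk 1 (deriv (deriv e)) := PeriodicCk.deriv he'
  have hf0 := hf.hasDerivAt (k := 1)
  have hf1 := hf'.hasDerivAt (k := 0)
  have hw0 := hw.hasDerivAt (k := 1)
  have hw1 := hw'.hasDerivAt (k := 0)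
  have hψ : UniformContinuous fun t => (deriv f t * (-deriv e t * weight F₀ t ^ 2)
        + f t * (-deriv (deriv e) t * weight F₀ t ^ 2
          - 2 * deriv e t * weight F₀ t * deriv (weight F₀) t)) * weight F₀ t
        + (deriv f t * weight F₀ t + f t * deriv (weight F₀) t)
          * (-deriv e t * weight F₀ t ^ 2) := by
    have c1 := hf.continuous
    have c2 := hf'.continuous
    have c3 := hw.continuous
    have c4 := hw'.continuous
    have c5 := he'.continuous
    have c6 := he''.continuous
    refine uniformContinuous_of_periodic (by fun_prop) fun t => ?_
    simp only [hf.periodic t, hf'.periodic t, hw.periodic t, hw'.periodic t, he'.periodic t,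
      he''.periodic t]
  have hw₁ : PeriodicCk 1 (weight F₀) := hw.of_le one_le_two
  have h1 := h.tendstoUniformly_slope_branchSum
    (h.unifSlope_deriv_integrand hf.exists_abs_le hf'.exists_abs_le)
    (((hf'.mul hw₁).add ((hf.of_le one_le_two).mul hw')).mul hw₁) hψ
  have e1 : ∀ t, deriv (fun t => (deriv f t * weight F₀ t + f t * deriv (weight F₀) t)
      * weight F₀ t) t = (deriv (deriv f) t * weight F₀ t + 2 * deriv f t * deriv (weight F₀) t
        + f t * deriv (deriv (weight F₀)) t) * weight F₀ t
        + (deriv f t * weight F₀ t + f t * deriv (weight F₀) t) * deriv (weight F₀) t :=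
    fun t => by
      rw [((((hf1 t).fun_mul (hw0 t)).fun_add ((hf0 t).fun_mul (hw1 t))).fun_mul
        (hw0 t)).deriv]
      ring
  simp only [e1] at h1
  rw [h.deriv_liftDerivOp hf]
  have e2 := fun δ (hδ : ExpandingLift d (F δ)) =>
    hδ.deriv_liftTransfer (hf.of_le (l := 1) one_le_two).contDiff
  have e3 := h.base.deriv_liftTransfer (hf.of_le (l := 1) one_le_two).contDiff
  refine (TendstoUniformly.congr_of_eventually (u₀ := _) ?_ (h.lift.mono fun δ hδ x => by
    rw [e2 δ hδ, e3]))
  convert h1 using 1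
  refine congrArg (branchSum d F₀) (funext fun t => ?_)
  ring

theorem tendstoUniformly_liftTransfer (h : LiftFamily d F F₀ e) {f : ℝ → ℝ}
    (hf : PeriodicCk 0 f) :
    TendstoUniformly (fun δ => liftTransfer d (F δ) f) (liftTransfer d F₀ f) (𝓝[>] 0) :=
  h.tendstoUniformly_branchSum (h.unifSlope_liftTransfer_integrand hf.exists_abs_le).tendsto
    (hf.mul (h.base.periodicCk_weight.of_le (Nat.zero_le _))).uniformContinuous

/-- For a `C^1` function, such as the response `v`, only convergence without a rate is obtained, and
that is all the response estimate needs. -/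
theorem tendstoUniformly_deriv_liftTransfer (h : LiftFamily d F F₀ e) {f : ℝ → ℝ}
    (hf : PeriodicCk 1 f) :
    TendstoUniformly (fun δ => deriv (liftTransfer d (F δ) f)) (deriv (liftTransfer d F₀ f))
      (𝓝[>] 0) := by
  have hf' : PeriodicCk 0 (deriv f) := PeriodicCk.deriv hf
  have hf0 := hf.of_le (Nat.zero_le 1)
  have hw : PeriodicCk 0 (weight F₀) := h.base.periodicCk_weight.of_le (Nat.zero_le _)
  have hw' : PeriodicCk 0 (deriv (weight F₀)) :=
    (PeriodicCk.deriv (k := 1) h.base.periodicCk_weight).of_le (Nat.zero_le _)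
  have h1 := h.tendstoUniformly_branchSum
    (h.unifSlope_deriv_integrand hf.exists_abs_le hf'.exists_abs_le).tendsto
    (((hf'.mul hw).add (hf0.mul hw')).mul hw).uniformContinuous
  rw [h.base.deriv_liftTransfer hf.contDiff]
  refine h1.congr_of_eventually ?_
  filter_upwards [h.lift] with δ hδ x
  rw [hδ.deriv_liftTransfer hf.contDiff]

/-- The maps of the family share one cone. -/
theorem exists_eventually_strictCone (h : LiftFamily d F F₀ e) :
    ∃ a κ, ∀ᶠ δ in 𝓝[>] 0, StrictCone 1 d a κ (F δ) := by
  obtain ⟨θ, hθ1, hθ⟩ := h.base.exists_weight_le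
  obtain ⟨K, hK⟩ := (PeriodicCk.deriv (k := 1) h.base.periodicCk_weight).exists_abs_le
  -- The bounds `θ` and `K` of the base map are relaxed to `(1 + θ) / 2 < 1` and `K + 1`, which hold
  -- for all small `δ > 0`.
  refine ⟨coneConst ((1 + θ) / 2) (K + 1), (1 + (1 + θ) / 2) / 2, ?_⟩
  filter_upwards [tendstoUniformly_iff_abs.1 h.unifSlope_weight.tendsto ((1 - θ) / 2)
    (by linarith), tendstoUniformly_iff_abs.1 h.unifSlope_deriv_weight.tendsto 1 one_pos,
    h.lift] with δ h1 h2 h3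
  refine h3.strictCone_one (fun t => ?_) (by linarith) fun t => ?_
  · linarith [hθ t, (abs_lt.1 (h1 t)).2]
  · have := abs_add_le (deriv (weight (F δ)) t - deriv (weight F₀) t) (deriv (weight F₀) t)
    rw [sub_add_cancel] at this
    linarith [h2 t, hK t]

/-- Linear response for the lifted operators, in `C^1`. -/
theorem linear_response (h : LiftFamily d F F₀ e) {f : ℝ → ℝ → ℝ} {f₀ v : ℝ → ℝ}
    (hf₀ : PeriodicCk 2 f₀) (hf₀L : ∀ t, liftTransfer d F₀ f₀ t = f₀ t)
    (hf₀I : ∫ t in (0 : ℝ)..1, f₀ t = 1)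
    (hf : ∀ᶠ δ in 𝓝[>] 0, PeriodicCk 1 (f δ) ∧ ∫ t in (0 : ℝ)..1, f δ t = 1 ∧
      ∀ t, liftTransfer d (F δ) (f δ) t = f δ t)
    (hv : PeriodicCk 1 v) (hv0 : ∫ t in (0 : ℝ)..1, v t = 0)
    (hvg : ∀ t, v t - liftTransfer d F₀ v t = liftDerivOp d F₀ e f₀ t) {c : ℝ} (hc : 0 < c) :
    ∀ᶠ δ in 𝓝[>] 0, CkBound 1 c fun t => (f δ t - f₀ t) / δ - v t := by
  obtain ⟨a, κ, hcone⟩ := h.exists_eventually_strictCone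
  have hC : ∃ C : ℝ, 0 < C ∧ 4 * a ^ 1 * Real.exp a * (coneGap a κ)⁻¹ ≤ C :=
    ⟨|4 * a ^ 1 * Real.exp a * (coneGap a κ)⁻¹| + 1, by positivity,
      (le_abs_self _).trans (by linarith)⟩
  obtain ⟨C, hC0, hC⟩ := hC
  have hb : 0 < c / C / 2 := by positivity
  filter_upwards [hcone, hf,
    tendstoUniformly_iff_abs.1 (h.tendstoUniformly_slope_liftTransfer hf₀) _ hb,
    tendstoUniformly_iff_abs.1 (h.tendstoUniformly_slope_deriv_liftTransfer hf₀) _ hb,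
    tendstoUniformly_iff_abs.1 (h.tendstoUniformly_liftTransfer (hv.of_le (Nat.zero_le _))) _ hb,
    tendstoUniformly_iff_abs.1 (h.tendstoUniformly_deriv_liftTransfer hv) _ hb]
    with δ hδ hfδ h1 h2 h3 h4
  obtain ⟨hfp, hfI, hfL⟩ := hfδ
  have hf₀1 := hf₀.of_le one_le_two
  have hD : PeriodicCk 1 fun t => (liftTransfer d (F δ) f₀ t - liftTransfer d F₀ f₀ t) / δ := by
    have := (((hδ.periodicCk_liftTransfer hf₀1).sub
      (⟨h.base.contDiff_liftTransfer le_rfl one_le_two hf₀1.contDiff,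
        h.base.liftTransfer_periodic hf₀.periodic⟩ : PeriodicCk 1 _)).const_mul δ⁻¹)
    simpa only [div_eq_inv_mul] using this
  have hLv : PeriodicCk 1 (liftTransfer d F₀ v) :=
    ⟨h.base.contDiff_liftTransfer le_rfl one_le_two hv.contDiff,
      h.base.liftTransfer_periodic hv.periodic⟩
  have hLδv := hδ.periodicCk_liftTransfer hv
  have hg := h.periodicCk_liftDerivOp hf₀
  have b1 : CkBound 1 (c / C / 2) fun t =>
      (liftTransfer d (F δ) f₀ t - liftTransfer d F₀ f₀ t) / δ - liftDerivOp d F₀ e f₀ t := by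
    refine ckBound_one_iff.2 ⟨fun t => (h1 t).le, fun t => ?_⟩
    rw [((hD.hasDerivAt (k := 0) t).fun_sub (hg.hasDerivAt (k := 0) t)).deriv, deriv_div_const,
      (((hδ.periodicCk_liftTransfer hf₀1).hasDerivAt (k := 0) t).fun_sub
        ((h.base.contDiff_liftTransfer le_rfl one_le_two hf₀1.contDiff).differentiable
          (by norm_num) t).hasDerivAt).deriv]
    exact (h2 t).le
  have b2 : CkBound 1 (c / C / 2) fun t => liftTransfer d (F δ) v t - liftTransfer d F₀ v t := by
    refine ckBound_one_iff.2 ⟨fun t => (h3 t).le, fun t => ?_⟩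
    rw [((hLδv.hasDerivAt (k := 0) t).fun_sub (hLv.hasDerivAt (k := 0) t)).deriv]
    exact (h4 t).le
  have b3 := b1.add b2 (hD.sub hg).contDiff (hLδv.sub hLv).contDiff
  have hq : PeriodicCk 1 fun t => (f δ t - f₀ t) / δ := by
    have := (hfp.sub hf₀1).const_mul δ⁻¹
    simpa only [div_eq_inv_mul] using this
  have hw : PeriodicCk 1 fun t => (f δ t - f₀ t) / δ - v t := hq.sub hv
  have hw0 : ∫ t in (0 : ℝ)..1, ((f δ t - f₀ t) / δ - v t) = 0 := by
    rw [intervalIntegral.integral_sub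
      (hq.continuous.intervalIntegrable _ _)
      (hv.continuous.intervalIntegrable _ _), hv0, intervalIntegral.integral_div,
      intervalIntegral.integral_sub (hfp.continuous.intervalIntegrable _ _)
      (hf₀.continuous.intervalIntegrable _ _), hfI, hf₀I]
    simp
  have hL : ∀ t, liftTransfer d (F δ) (fun t => (f δ t - f₀ t) / δ - v t) t
      = (f δ t - liftTransfer d (F δ) f₀ t) / δ - liftTransfer d (F δ) v t := fun t => by
    simp only [liftTransfer_sub, div_eq_inv_mul, liftTransfer_const_mul, hfL]
  -- The resolvent identity: `1 - L_δ` applied to the error splits into the remainder of the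
  -- expansion at `f₀` and `(L_δ - L_0) v`.
  have e3 : (fun t => ((f δ t - f₀ t) / δ - v t)
      - liftTransfer d (F δ) (fun t => (f δ t - f₀ t) / δ - v t) t)
      = fun t => ((liftTransfer d (F δ) f₀ t - liftTransfer d F₀ f₀ t) / δ
        - liftDerivOp d F₀ e f₀ t) + (liftTransfer d (F δ) v t - liftTransfer d F₀ v t) := by
    funext t
    rw [hL, ← hvg, hf₀L]; ring
  rw [← e3] at b3
  refine (hδ.ckBound_of_sub_liftTransfer hw hw0 b3).mono ?_
  calc 4 * a ^ 1 * Real.exp a * (c / C / 2 + c / C / 2) * (coneGap a κ)⁻¹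
      = 4 * a ^ 1 * Real.exp a * (coneGap a κ)⁻¹ * (c / C) := by ring
    _ ≤ C * (c / C) := mul_le_mul_of_nonneg_right hC (by positivity)
    _ = c := by field_simp

end LiftFamily

end CircleMap

/-! ### Transfer between the circle and the line. -/

namespace CircleMap

/-- A function on the circle, seen as a periodic function on the line. -/
def toLine (f : X → ℝ) (t : ℝ) : ℝ := f (t : X)

theorem toLine_periodic (f : X → ℝ) : Function.Periodic (toLine f) 1 := fun t => by
  simp [toLine]

theorem toLine_injective : Function.Injective toLine := fun f g h => by
  funext x
  induction x using QuotientAddGroup.induction_on with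
  | H t => exact congrFun h t

theorem continuous_iff_toLine {f : X → ℝ} : Continuous f ↔ Continuous (toLine f) :=
  continuous_coinduced_dom

theorem exists_toLine_eq {v : ℝ → ℝ} (hv : Function.Periodic v 1) : ∃ f : X → ℝ, toLine f = v :=
  ⟨hv.lift, funext fun t => hv.lift_coe t⟩

theorem integral_eq_toLine (f : X → ℝ) : ∫ x : X, f x = ∫ t in (0 : ℝ)..1, toLine f t := by
  have := UnitAddCircle.intervalIntegral_preimage 0 f
  rw [zero_add] at this
  exact this.symm

theorem toLine_fderivX (f : X → ℝ) : toLine (fderivX f) = deriv (toLine f) := by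
  funext t
  have h := deriv_comp_const_add (f := toLine f) t 0
  rw [add_zero] at h
  rw [← h]
  simp only [toLine, fderivX, AddCircle.coe_add]

theorem toLine_iterate_fderivX (f : X → ℝ) (k : ℕ) :
    toLine (fderivX^[k] f) = iteratedDeriv k (toLine f) := by
  induction k with
  | zero => simp
  | succ k ih => rw [Function.iterate_succ_apply', toLine_fderivX, ih, iteratedDeriv_succ]

theorem IsCk.periodicCk {k : ℕ} {f : X → ℝ} (hf : IsCk k f) : PeriodicCk k (toLine f) :=
  ⟨hf, toLine_periodic f⟩

theorem IsW11.continuous {f : X → ℝ} (hf : IsW11 f) : Continuous f := by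
  have hc : ContinuousOn (toLine f) (Icc 0 (0 + 1)) := by
    have h1 : ContinuousOn (toLine f) (uIcc 0 1) := AbsolutelyContinuousOnInterval.continuousOn hf
    rwa [uIcc_of_le zero_le_one, ← zero_add (1 : ℝ)] at h1
  have h1 := AddCircle.liftIco_continuous (p := (1 : ℝ)) (a := 0) (f := toLine f)
    (toLine_periodic f 0).symm hc
  -- Continuity on `[0, 1]` with equal end values glues to continuity on the circle; it remains to
  -- see that the glued function is `f`.
  have h2 : AddCircle.liftIco (1 : ℝ) 0 (toLine f) = f := by
    refine toLine_injective (funext fun t => ?_)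
    obtain ⟨y, hy, e⟩ := (toLine_periodic fun x =>
      AddCircle.liftIco (1 : ℝ) 0 (toLine f) x - f x).exists_mem_Ico one_pos t 0
    simp only [toLine] at e
    have h4 := AddCircle.liftIco_coe_apply (f := toLine f) hy
    rw [h4] at e
    simp only [toLine, sub_self] at e
    exact sub_eq_zero.1 e
  rwa [h2] at h1

theorem PeriodicCk.isW11 {f : X → ℝ} (hf : PeriodicCk 1 (toLine f)) : IsW11 f :=
  hf.contDiff.contDiffOn.absolutelyContinuousOnInterval

theorem w11Norm_nonneg (f : X → ℝ) : 0 ≤ w11Norm f :=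
  add_nonneg (integral_nonneg fun _ => abs_nonneg _) (integral_nonneg fun _ => abs_nonneg _)

theorem w11Norm_le {f : X → ℝ} {c : ℝ} (hf : CkBound 1 c (toLine f)) : w11Norm f ≤ 2 * c := by
  have key : ∀ {g : X → ℝ}, (∀ t, |toLine g t| ≤ c) → ∫ x : X, |g x| ≤ c := fun {g} hg => by
    have h1 := norm_integral_le_of_norm_le_const (μ := (volume : Measure X)) (f := fun x => |g x|)
      (C := c) (Eventually.of_forall fun x => by
        rw [Real.norm_eq_abs, abs_abs]
        induction x using QuotientAddGroup.induction_on with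
        | H t => exact hg t)
    simp only [measureReal_def, UnitAddCircle.measure_univ, ENNReal.toReal_one, mul_one] at h1
    exact (le_abs_self _).trans h1
  have h1 := key (ckBound_one_iff.1 hf).1
  have h2 := key (g := fderivX f) fun t => by
    rw [toLine_fderivX]; exact (ckBound_one_iff.1 hf).2 t
  unfold w11Norm
  linarith

/-- Convergence in `C^1` implies convergence in `W^{1,1}`. -/
theorem tendstoW11_of_ckBound {ι : Type*} {l : Filter ι} {u : ι → X → ℝ} {f : X → ℝ}
    (hu : ∀ᶠ i in l, PeriodicCk 1 (toLine (u i))) (hf : PeriodicCk 1 (toLine f))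
    (h : ∀ c > 0, ∀ᶠ i in l, CkBound 1 c fun t => toLine (u i) t - toLine f t) :
    TendstoW11 u l f := by
  refine ⟨hu.mono fun i hi => hi.isW11, hf.isW11, ?_⟩
  rw [Metric.tendsto_nhds]
  intro c hc
  filter_upwards [h (c / 4) (by linarith)] with i hi
  rw [Real.dist_eq, sub_zero, abs_of_nonneg (w11Norm_nonneg _)]
  exact (w11Norm_le (f := fun x => u i x - f x) hi).trans_lt (by linarith)

/-- `F` is a lift of the circle map `T`. -/
structure IsLift (d : ℕ) (F : ℝ → ℝ) (T : X → X) : Prop extends ExpandingLift d F where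
  coe : ∀ t : ℝ, T (t : X) = (F t : X)

theorem coe_eq_coe_iff {s t : ℝ} : (s : X) = (t : X) ↔ ∃ n : ℤ, s = t + n := by
  rw [← sub_eq_zero, ← AddCircle.coe_sub, AddCircle.coe_eq_zero_iff]
  simp only [zsmul_eq_mul, mul_one]
  exact exists_congr fun n => ⟨fun h => by linarith, fun h => by linarith⟩

theorem IsExpandingC3.one_lt_deriv {T : X → X} (hT : IsExpandingC3 T) {F : ℝ → ℝ}
    (hF : Continuous F) (h : ∀ t : ℝ, T (t : X) = (F t : X)) (t : ℝ) : 1 < deriv F t := by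
  rw [← mapDeriv_of_lift h t hF.continuousAt]
  exact hT.expanding t

theorem IsExpandingC3.exists_isLift {T : X → X} (hT : IsExpandingC3 T) :
    ∃ d F, IsLift d F T := by
  obtain ⟨F, hF, hc⟩ := hT.smooth
  have hn : ∀ t, ∃ n : ℤ, F (t + 1) = F t + n := fun t => by
    rw [← coe_eq_coe_iff, ← hc, ← hc]; simp
  choose n hn using hn
  -- The integer `F (t + 1) - F t` depends continuously on `t`, hence is constant. It is the degree,
  -- positive because `F` increases.
  have hcont : Continuous n := by
    rw [Int.isClosedEmbedding_coe_real.isEmbedding.continuous_iff]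
    have e : (fun m : ℤ => (m : ℝ)) ∘ n = fun t => F (t + 1) - F t := by
      funext t; simp [hn]
    rw [e]
    exact (hF.continuous.comp (continuous_id.add continuous_const)).sub hF.continuous
  have hconst : ∀ t, n t = n 0 := fun t => PreconnectedSpace.constant inferInstance hcont
  have h1 := fun t => hT.one_lt_deriv hF.continuous hc t
  have hpos : 0 < n 0 := by
    have h2 : StrictMono F := strictMono_of_deriv_pos fun t => one_pos.trans (h1 t)
    have h3 := h2 (show (0 : ℝ) < 0 + 1 by norm_num)
    rw [hn] at h3
    exact_mod_cast (by linarith : (0 : ℝ) < n 0)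
  obtain ⟨d, hd⟩ := Int.eq_ofNat_of_zero_le hpos.le
  refine ⟨d, F, ⟨hF, fun t => ?_, h1⟩, hc⟩
  rw [hn, hconst, hd]; simp

namespace IsLift

variable {d : ℕ} {F : ℝ → ℝ} {T : X → X}

theorem toLine_mapDeriv (h : IsLift d F T) : toLine (mapDeriv T) = deriv F :=
  funext fun t => mapDeriv_of_lift h.coe t h.contDiff.continuous.continuousAt

theorem continuous_map (h : IsLift d F T) : Continuous T := by
  refine continuous_coinduced_dom.2 ?_
  have e : T ∘ (fun t : ℝ => (t : X)) = fun t => (F t : X) := funext h.coe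
  exact e ▸ (AddCircle.continuous_mk' 1).comp h.contDiff.continuous

theorem add_intCast (h : IsLift d F T) (t : ℝ) (n : ℤ) : F (t + n) = F t + n * d := by
  have hp : Function.Periodic (fun t => F t - d * t) 1 := fun t => by
    simp only [h.add_one]; ring
  have := hp.int_mul n t
  simp only [mul_one] at this
  linarith

theorem preimage_eq (h : IsLift d F T) (x : ℝ) :
    T ⁻¹' {(x : X)} = (fun i : ℕ => ((invLift F (x + i) : ℝ) : X)) '' Finset.range d := by
  ext y
  induction y using QuotientAddGroup.induction_on with
  | H s =>
    have hd : (0 : ℤ) < d := by exact_mod_cast h.degree_pos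
    constructor
    · intro hs
      have h1 : ((F s : ℝ) : X) = x := (h.coe s).symm.trans hs
      -- If `F s = x + m`, the remainder of `m` modulo `d` selects the branch, and the quotient is
      -- an integer translation of `s`.
      obtain ⟨m, hm⟩ := coe_eq_coe_iff.1 h1
      obtain ⟨i, hi⟩ := Int.eq_ofNat_of_zero_le (Int.emod_nonneg m hd.ne')
      refine ⟨i, ?_, ?_⟩
      · have := Int.emod_lt_of_pos m hd
        rw [hi] at this
        simpa using this
      · symm
        refine coe_eq_coe_iff.2 ⟨m / d, h.strictMono.injective ?_⟩
        rw [h.add_intCast, h.apply_invLift, hm, add_assoc]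
        congr 1
        have h2 := Int.emod_add_mul_ediv m d
        rw [hi] at h2
        have h3 : ((i : ℤ) : ℝ) + d * ((m / d : ℤ) : ℝ) = m := by exact_mod_cast h2
        rw [← h3]; simp [mul_comm]
    · rintro ⟨i, -, hi⟩
      have h1 : T (s : X) = (x : X) := by
        have hi' : ((invLift F (x + i) : ℝ) : X) = (s : X) := hi
        rw [← hi', h.coe, h.apply_invLift]
        exact coe_eq_coe_iff.2 ⟨i, by simp⟩
      exact h1

/-- Two branches that agree on the circle have indices congruent modulo `d`. -/
theorem injOn_branch (h : IsLift d F T) (x : ℝ) :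
    InjOn (fun i : ℕ => ((invLift F (x + i) : ℝ) : X)) (Finset.range d) := by
  intro i hi j hj hij
  obtain ⟨n, hn⟩ := coe_eq_coe_iff.1 hij
  have h1 := congrArg F hn
  rw [h.add_intCast, h.apply_invLift, h.apply_invLift] at h1
  have h2 : (i : ℤ) = j + n * d := by
    have : (i : ℝ) = j + n * d := by linarith
    exact_mod_cast this
  have hi' : (i : ℤ) < d := by simpa using hi
  have hj' : (j : ℤ) < d := by simpa using hj
  have h3 : (i : ℤ) % d = j % d := by rw [h2]; simp
  rw [Int.emod_eq_of_lt (by omega) hi', Int.emod_eq_of_lt (by omega) hj'] at h3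
  exact_mod_cast h3

theorem toLine_transfer (h : IsLift d F T) (f : X → ℝ) :
    toLine (transfer T f) = liftTransfer d F (toLine f) := by
  funext x
  have e1 : ∀ t : ℝ, mapDeriv T (t : X) = deriv F t := congrFun h.toLine_mapDeriv
  rw [toLine, transfer, h.preimage_eq, finsum_mem_image (h.injOn_branch x),
    finsum_mem_coe_finset]
  refine Finset.sum_congr rfl fun i _ => ?_
  rw [e1, abs_of_pos (h.deriv_pos _), div_eq_mul_inv]
  rfl

theorem toLine_iterate_transfer (h : IsLift d F T) (f : X → ℝ) (n : ℕ) :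
    toLine ((transfer T)^[n] f) = (liftTransfer d F)^[n] (toLine f) := by
  induction n with
  | zero => rfl
  | succ n ih =>
    rw [Function.iterate_succ_apply', Function.iterate_succ_apply', h.toLine_transfer, ih]

theorem continuous_transfer (h : IsLift d F T) {f : X → ℝ} (hf : Continuous f) :
    Continuous (transfer T f) := by
  rw [continuous_iff_toLine, h.toLine_transfer]
  exact h.continuous_liftTransfer (continuous_iff_toLine.1 hf)

theorem integral_mul_transfer (h : IsLift d F T) {f φ : X → ℝ} (hf : Continuous f)
    (hφ : Continuous φ) : ∫ x : X, φ x * transfer T f x = ∫ x : X, φ (T x) * f x := by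
  have h1 := h.integral_mul_liftTransfer (continuous_iff_toLine.1 hf)
    (continuous_iff_toLine.1 hφ) (toLine_periodic f) (toLine_periodic φ)
  rw [integral_eq_toLine, integral_eq_toLine]
  have e1 : toLine (fun x => φ x * transfer T f x)
      = fun t => toLine φ t * liftTransfer d F (toLine f) t := by
    rw [← h.toLine_transfer]; rfl
  have e2 : toLine (fun x => φ (T x) * f x) = fun t => toLine φ (F t) * toLine f t :=
    funext fun t => by simp only [toLine, h.coe]
  rw [e1, e2, h1]

end IsLift

theorem integral_withDensity_ofReal {f φ : X → ℝ} (hf : Continuous f) (h0 : ∀ x, 0 ≤ f x) :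
    ∫ x, φ x ∂((volume : Measure X).withDensity fun x => ENNReal.ofReal (f x))
      = ∫ x : X, φ x * f x := by
  have hm : Measurable fun x => ENNReal.ofReal (f x) := hf.measurable.ennreal_ofReal
  rw [integral_withDensity_eq_integral_toReal_smul hm (by simp)]
  refine integral_congr_ae (Eventually.of_forall fun x => ?_)
  simp only [ENNReal.toReal_ofReal (h0 x), smul_eq_mul, mul_comm]

namespace IsLift

variable {d : ℕ} {F : ℝ → ℝ} {T : X → X}

/-- A continuous nonnegative density is invariant iff it is fixed by the transfer operator. -/
theorem measurePreserving_iff (h : IsLift d F T) {f : X → ℝ} (hf : Continuous f)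
    (h0 : ∀ x, 0 ≤ f x) :
    MeasurePreserving T ((volume : Measure X).withDensity fun x => ENNReal.ofReal (f x))
      ((volume : Measure X).withDensity fun x => ENNReal.ofReal (f x)) ↔ transfer T f = f := by
  have hTm : Measurable T := h.continuous_map.measurable
  have hint : ∀ {g : X → ℝ}, Continuous g → Integrable g (volume : Measure X) := fun {g} hg =>
    hg.integrable_of_hasCompactSupport (HasCompactSupport.of_compactSpace g)
  constructor
  · intro hm
    have key : ∀ φ : X → ℝ, Continuous φ → ∫ x : X, φ x * (transfer T f x - f x) = 0 := by
      intro φ hφ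
      have h1 : ∫ x, φ x ∂((volume : Measure X).withDensity fun x => ENNReal.ofReal (f x))
          = ∫ x, φ (T x) ∂((volume : Measure X).withDensity fun x => ENNReal.ofReal (f x)) := by
        conv_lhs => rw [← hm.map_eq]
        exact integral_map hTm.aemeasurable hφ.aestronglyMeasurable
      rw [integral_withDensity_ofReal hf h0,
        integral_withDensity_ofReal (φ := fun x => φ (T x)) hf h0,
        ← h.integral_mul_transfer hf hφ] at h1
      have i1 : Integrable fun x => φ x * transfer T f x :=
        hint (hφ.mul (h.continuous_transfer hf))
      have i2 : Integrable fun x => φ x * f x := hint (hφ.mul hf)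
      simp only [mul_sub]
      rw [integral_sub i1 i2, h1, sub_self]
    have hc : Continuous fun x => transfer T f x - f x := (h.continuous_transfer hf).sub hf
    -- The test function is `L f - f` itself; its square has zero integral and is continuous, so it
    -- vanishes everywhere.
    have h1 := key _ hc
    rw [integral_eq_zero_iff_of_nonneg (fun x => mul_self_nonneg _) (hint (hc.mul hc))] at h1
    have h2 := (Continuous.ae_eq_iff_eq volume (hc.mul hc) continuous_const).1 h1
    funext x
    exact sub_eq_zero.1 (mul_self_eq_zero.1 (congrFun h2 x))
  · intro hL
    refine ⟨hTm, ?_⟩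
    have : IsFiniteMeasure ((volume : Measure X).withDensity fun x => ENNReal.ofReal (f x)) :=
      isFiniteMeasure_withDensity_ofReal (hint hf).2
    refine ext_of_forall_integral_eq_of_IsFiniteMeasure fun φ => ?_
    rw [integral_map hTm.aemeasurable φ.continuous.aestronglyMeasurable,
      integral_withDensity_ofReal (φ := fun x => φ (T x)) hf h0,
      integral_withDensity_ofReal hf h0, ← h.integral_mul_transfer hf φ.continuous, hL]

theorem isInvariantDensity_iff (h : IsLift d F T) {f : X → ℝ} :
    IsInvariantDensity T f ↔ IsW11 f ∧ (∀ x, 0 ≤ f x) ∧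
      ∫ t in (0 : ℝ)..1, toLine f t = 1 ∧
      ∀ t, liftTransfer d F (toLine f) t = toLine f t := by
  have e : transfer T f = f ↔ ∀ t, liftTransfer d F (toLine f) t = toLine f t := by
    rw [← toLine_injective.eq_iff, h.toLine_transfer, funext_iff]
  rw [← integral_eq_toLine, ← e]
  constructor
  · rintro ⟨h1, h2, h3, h4⟩
    exact ⟨h1, h2, h3, (h.measurePreserving_iff h1.continuous h2).1 h4⟩
  · rintro ⟨h1, h2, h3, h4⟩
    exact ⟨h1, h2, h3, (h.measurePreserving_iff h1.continuous h2).2 h4⟩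

/-- Existence, uniqueness and regularity of the invariant density. -/
theorem exists_isInvariantDensity (h : IsLift d F T) :
    ∃ f, IsInvariantDensity T f ∧ IsCk 2 f ∧ ∀ g, IsInvariantDensity T g → g = f := by
  obtain ⟨v, hv, hv0, hvI, hvL⟩ := h.exists_invariant
  obtain ⟨f, rfl⟩ := exists_toLine_eq hv.periodic
  refine ⟨f, h.isInvariantDensity_iff.2 ⟨(hv.of_le one_le_two).isW11, fun x => ?_, hvI, hvL⟩,
    hv.contDiff, fun g hg => ?_⟩
  · induction x using QuotientAddGroup.induction_on with
    | H t => exact (hv0 t).le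
  · obtain ⟨h1, -, h3, h4⟩ := h.isInvariantDensity_iff.1 hg
    exact toLine_injective (h.eq_of_fixed (continuous_iff_toLine.1 h1.continuous)
      (toLine_periodic g) h4 h3 hv.continuous hv.periodic hvL hvI hv0)

/-- The three terms of `derivOp` are the product rule for `-(w * ε / T')'`, with `(1 / T')' = -T'' /
T' ^ 2`. -/
theorem toLine_derivOp (h : IsLift d F T) {ε w : X → ℝ} (hε : IsCk 3 ε) (hw : IsCk 2 w) :
    toLine (derivOp T ε w) = LiftFamily.liftDerivOp d F (toLine ε) (toLine w) := by
  have he := hε.periodicCk.hasDerivAt (k := 2)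
  have hw' := hw.periodicCk.hasDerivAt (k := 1)
  have e0 : toLine (derivOp T ε w) = fun t =>
      - toLine (transfer T fun y => w y * fderivX ε y / mapDeriv T y) t
      - toLine (transfer T fun y => ε y * fderivX w y / mapDeriv T y) t
      + toLine (transfer T fun y => ε y * fderivX (mapDeriv T) y / mapDeriv T y ^ 2 * w y) t := rfl
  have e1 : toLine (fun y => w y * fderivX ε y / mapDeriv T y) = fun t =>
      toLine w t * toLine (fderivX ε) t / toLine (mapDeriv T) t := rfl
  have e2 : toLine (fun y => ε y * fderivX w y / mapDeriv T y) = fun t =>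
      toLine ε t * toLine (fderivX w) t / toLine (mapDeriv T) t := rfl
  have e3 : toLine (fun y => ε y * fderivX (mapDeriv T) y / mapDeriv T y ^ 2 * w y) = fun t =>
      toLine ε t * toLine (fderivX (mapDeriv T)) t / toLine (mapDeriv T) t ^ 2 * toLine w t := rfl
  rw [e0, h.toLine_transfer, h.toLine_transfer, h.toLine_transfer, e1, e2, e3, toLine_fderivX,
    toLine_fderivX, toLine_fderivX, h.toLine_mapDeriv]
  funext x
  simp only [liftTransfer, branchSum, LiftFamily.liftDerivOp, ← Finset.sum_neg_distrib,
    ← Finset.sum_sub_distrib, ← Finset.sum_add_distrib]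
  refine Finset.sum_congr rfl fun i _ => ?_
  rw [(((hw' _).fun_mul (h.hasDerivAt_weight _)).fun_mul (he _)).deriv, h.deriv_weight]
  simp only [weight, div_eq_mul_inv, inv_pow]
  ring

end IsLift

theorem abs_iteratedDeriv_le_c3Norm {r : X → ℝ} (hr : IsCk 3 r) {k : ℕ} (hk : k ≤ 3) (t : ℝ) :
    |iteratedDeriv k (toLine r) t| ≤ c3Norm r := by
  obtain ⟨M, hM⟩ := hr.periodicCk.exists_ckBound
  -- Boundedness is essential: a real supremum of an unbounded family defaults to `0`.
  have hb : BddAbove (range fun x : X => |fderivX^[k] r x|) := by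
    refine ⟨M, ?_⟩
    rintro _ ⟨x, rfl⟩
    induction x using QuotientAddGroup.induction_on with
    | H t =>
      have := hM k hk t
      rw [← toLine_iterate_fderivX] at this
      exact this
  rw [← toLine_iterate_fderivX]
  refine (le_ciSup hb (t : X)).trans ?_
  exact Finset.single_le_sum (f := fun k => ⨆ x : X, |fderivX^[k] r x|)
    (fun _ _ => Real.iSup_nonneg fun _ => abs_nonneg _) (Finset.mem_range.2 (by omega))

/-- A differentiable family of expanding maps has a differentiable family of lifts. -/
theorem IsDifferentiableFamily.exists_liftFamily {η : ℝ} (hη : 0 < η) {T : ℝ → X → X}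
    {ε : X → ℝ} (hT : IsDifferentiableFamily η T ε) {d : ℕ} {F₀ : ℝ → ℝ}
    (h0 : IsLift d F₀ (T 0)) :
    ∃ F : ℝ → ℝ → ℝ, LiftFamily d F F₀ (toLine ε) ∧ ∀ᶠ δ in 𝓝[>] 0, IsLift d (F δ) (T δ) := by
  obtain ⟨r, hr, hr0⟩ := hT.expansion
  have he : PeriodicCk 3 (toLine ε) := hT.smooth.periodicCk
  -- The perturbation is periodic, so this lift of `T δ` has the same degree as `F₀`.
  set F : ℝ → ℝ → ℝ := fun δ t => F₀ t + (δ * toLine ε t + toLine (r δ) t) with hF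
  have hlift : ∀ᶠ δ in 𝓝[>] (0 : ℝ), IsLift d (F δ) (T δ) := by
    filter_upwards [hr, self_mem_nhdsWithin, nhdsWithin_le_nhds (Iio_mem_nhds hη)]
      with δ h1 h2 h3
    have hc : ContDiff ℝ 3 (F δ) :=
      h0.contDiff.add ((contDiff_const.mul he.contDiff).add h1.1)
    have hcoe : ∀ t : ℝ, T δ (t : X) = (F δ t : X) := fun t => by
      rw [h1.2, h0.coe, hF, AddCircle.coe_add]; rfl
    refine ⟨⟨hc, fun t => ?_, (hT.expanding δ ⟨(le_of_lt h2), h3⟩).one_lt_deriv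
      hc.continuous hcoe⟩, hcoe⟩
    simp only [hF, h0.add_one, toLine_periodic _ t]
    ring
  have hslope : ∀ k ≤ 2, TendstoUniformly
      (fun δ t => (iteratedDeriv k (F δ) t - iteratedDeriv k F₀ t) / δ)
      (iteratedDeriv k (toLine ε)) (𝓝[>] 0) := fun k hk => by
    refine tendstoUniformly_of_abs_le (b := fun δ => c3Norm (r δ) / δ) ?_ hr0
    filter_upwards [hr, self_mem_nhdsWithin] with δ h1 h2 t
    have h3 : (0 : ℝ) < δ := h2
    have hk3 : (k : WithTop ℕ∞) ≤ 3 := by exact_mod_cast (by omega : k ≤ 3)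
    have c1 : ContDiffAt ℝ k F₀ t := (h0.contDiff.of_le hk3).contDiffAt
    have c2 : ContDiffAt ℝ k (toLine ε) t := (he.contDiff.of_le hk3).contDiffAt
    have c3 : ContDiffAt ℝ k (toLine (r δ)) t :=
      (h1.1.periodicCk.contDiff.of_le hk3).contDiffAt
    have e : iteratedDeriv k (F δ) t = iteratedDeriv k F₀ t
        + (δ * iteratedDeriv k (toLine ε) t + iteratedDeriv k (toLine (r δ)) t) := by
      rw [hF, iteratedDeriv_fun_add c1 ((contDiffAt_const.mul c2).add c3),
        iteratedDeriv_fun_add (contDiffAt_const.mul c2) c3, iteratedDeriv_const_mul_field]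
    have e2 : (iteratedDeriv k (F δ) t - iteratedDeriv k F₀ t) / δ
        - iteratedDeriv k (toLine ε) t = iteratedDeriv k (toLine (r δ)) t / δ := by
      rw [e]; field_simp; ring
    rw [e2, abs_div, abs_of_pos h3]
    exact div_le_div_of_nonneg_right (abs_iteratedDeriv_le_c3Norm h1.1 (by omega) t) h3.le
  refine ⟨F, ⟨h0.toExpandingLift, hlift.mono fun _ h => h.toExpandingLift, he, ?_, ?_, ?_⟩, hlift⟩
  · simpa using hslope 0 (by norm_num)
  · simpa using hslope 1 (by norm_num)
  · simpa [iteratedDeriv_succ] using hslope 2 le_rfl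

end CircleMap

/-! ### The theorem on the circle. -/

theorem mainTheorem4 (η : ℝ) (hη : 0 < η) (T : ℝ → X → X) (ε : X → ℝ)
    (hT : CircleMap.IsDifferentiableFamily η T ε) :
    (∀ δ ∈ Set.Ico 0 η, ∃! f : X → ℝ, CircleMap.IsInvariantDensity (T δ) f) ∧
    ∀ f : ℝ → X → ℝ,
      (∀ δ ∈ Set.Ico 0 η, CircleMap.IsInvariantDensity (T δ) (f δ)) →
      (∀ δ ∈ Set.Ico 0 η, CircleMap.IsCk 2 (f δ)) ∧
      ∃ h : X → ℝ,
        CircleMap.IsResolventAt (T 0) (CircleMap.derivOp (T 0) ε (f 0)) h ∧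
        CircleMap.TendstoW11 (fun δ : ℝ => fun x => (f δ x - f 0 x) / δ)
          (nhdsWithin 0 (Set.Ioi 0)) h := by
  open CircleMap in
  have hex : ∀ δ ∈ Set.Ico 0 η, ∃ f, IsInvariantDensity (T δ) f ∧ IsCk 2 f ∧
      ∀ g, IsInvariantDensity (T δ) g → g = f := fun δ hδ => by
    obtain ⟨d, F, hF⟩ := (hT.expanding δ hδ).exists_isLift
    exact hF.exists_isInvariantDensity
  refine ⟨fun δ hδ => ?_, fun f hf => ?_⟩
  · obtain ⟨g, h1, -, h2⟩ := hex δ hδ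
    exact ⟨g, h1, h2⟩
  have hC2 : ∀ δ ∈ Set.Ico 0 η, CircleMap.IsCk 2 (f δ) := fun δ hδ => by
    obtain ⟨g, -, h1, h2⟩ := hex δ hδ
    exact h2 _ (hf δ hδ) ▸ h1
  refine ⟨hC2, ?_⟩
  have h0η : (0 : ℝ) ∈ Set.Ico 0 η := ⟨le_rfl, hη⟩
  obtain ⟨d, F₀, h0⟩ := (hT.expanding 0 h0η).exists_isLift
  obtain ⟨F, hF, hlift⟩ := hT.exists_liftFamily hη h0
  have hf0 := (hC2 0 h0η).periodicCk
  obtain ⟨-, -, hI0, hL0⟩ := h0.isInvariantDensity_iff.1 (hf 0 h0η)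
  -- The `C^1` cone is used since `L̂ f_0` is only known to be `C^1`.
  have hcone := h0.exists_strictCone_one
  obtain ⟨a, κ, hcone⟩ := hcone
  have hg := hF.periodicCk_liftDerivOp hf0
  have hg0 : ∫ t in (0 : ℝ)..1, CircleMap.LiftFamily.liftDerivOp d F₀ (CircleMap.toLine ε)
      (CircleMap.toLine (f 0)) t = 0 := hF.integral_liftDerivOp hf0
  obtain ⟨v, hv, hv0, hvg, b, hb, hbn⟩ := hcone.exists_resolvent hg hg0
  obtain ⟨h, rfl⟩ := CircleMap.exists_toLine_eq hv.periodic
  have hD := h0.toLine_derivOp hT.smooth (hC2 0 h0η)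
  refine ⟨h, ⟨hv.isW11, ?_, fun x => ?_, ?_⟩, ?_⟩
  · rw [CircleMap.integral_eq_toLine, hv0]
  · induction x using QuotientAddGroup.induction_on with
    | H t =>
      have h1 := hvg t
      rw [← hD, ← h0.toLine_transfer] at h1
      exact h1
  · have e : ∀ n : ℕ, CircleMap.toLine (fun x => ∑ i ∈ Finset.range n,
        (CircleMap.transfer (T 0))^[i] (CircleMap.derivOp (T 0) ε (f 0)) x)
        = fun t => ∑ i ∈ Finset.range n, (CircleMap.liftTransfer d F₀)^[i]
          (CircleMap.LiftFamily.liftDerivOp d F₀ (CircleMap.toLine ε)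
            (CircleMap.toLine (f 0))) t := fun n => by
      rw [← hD]
      simp only [← h0.toLine_iterate_transfer]
      rfl
    refine CircleMap.tendstoW11_of_ckBound (Filter.Eventually.of_forall fun n => ?_) hv
      fun c hc => ?_
    · rw [e]
      exact CircleMap.PeriodicCk.sum _ fun i => hcone.periodicCk_iterate hg i
    · filter_upwards [hb.eventually_le_const hc] with n hn
      rw [e]
      exact (hbn n).mono hn
  · have hIco : ∀ᶠ δ in nhdsWithin (0 : ℝ) (Set.Ioi 0), δ ∈ Set.Ico 0 η := by
      filter_upwards [self_mem_nhdsWithin, nhdsWithin_le_nhds (Iio_mem_nhds hη)] with δ h1 h2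
      exact ⟨le_of_lt h1, h2⟩
    refine CircleMap.tendstoW11_of_ckBound ?_ hv fun c hc => ?_
    · filter_upwards [hIco] with δ hδ
      have := (((hC2 δ hδ).periodicCk.sub hf0).of_le one_le_two).const_mul δ⁻¹
      simp only [← div_eq_inv_mul] at this
      exact this
    · refine hF.linear_response (f := fun δ => CircleMap.toLine (f δ)) hf0 hL0 hI0 ?_ hv hv0 hvg hc
      filter_upwards [hIco, hlift] with δ hδ h1
      obtain ⟨-, -, h2, h3⟩ := h1.isInvariantDensity_iff.1 (hf δ hδ)
      exact ⟨(hC2 δ hδ).periodicCk.of_le one_le_two, h2, h3⟩
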